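/- Write $\log R=\max(\log_2 R,1)$ for $R>0$. A compact set $E\subset\{(x,y)\in\mathbb R^2:\frac12\le x\le\frac34\}$ of Lebesgue measure zero is called a Besicovitch set if for every $a\in[0,1]$ there is a $b$ such that $E$ contains the segment $y=ax+b$, $\frac12\le x\le\frac34$ (by rotation and dilation this is no restriction). For a gauge $h$, $\mathcal H^h$ denotes the Hausdorff measure in $\mathbb R^2$ with respect to $h$. Let $\{M_n\}_{n\ge1}$ be a non-decreasing sequence tending to infinity with $M_n=2^{m_n}$, $m_n$ positive integers. Let $\mathbb E_M$ be the set of the $2^M$ affine functions $$\ell(x)=\sum_{k=1}^M\frac{\varepsilon_k}{2^k}\,x-\sum_{k=1}^M\frac{k-1}{M}\,\frac{\varepsilon_k}{2^k},\qquad \varepsilon_k\in\{0,1\},$$ and put $\delta_n=2^{-M_1}\cdots2^{-M_n}$ (so $\delta_0=1$), $\mathbb F_0=\{0\}$, $\mathbb F_{n}=\{l+\delta_{n-1}\ell:\ l\in\mathbb F_{n-1},\ \ell\in\mathbb E_{M_n}\}$, $$\mathbf F_n=\bigcup_{l\in\mathbb F_n}\Big\{(x,y):\ \tfrac12\le x\le\tfrac34,\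 l(x)+\delta_n(x-1)\le y\le l(x)+\delta_nx\Big\},\qquad E_{\{M_n\}}=\bigcap_{n\ge1}\mathbf F_n .$$ These sets form the family $\mathcal K$. Then: (1) Every $E_{\{M_n\}}\in\mathcal K$ is a Besicovitch set. (2) If $\{M_n\}$ is strictly increasing, then $\mathcal H^{h}(E_{\{M_n\}})<\infty$ for $h(r)=r^2\log(1/r)$. (3) Let $\phi$ be a positive decreasing (not necessarily strictly) function on $(0,1]$ with $\phi(r)\to\infty$ as $r\to0$, with $\phi(r)<\log(1/r)$ for all sufficiently small $r$, and with $\phi(r^2)\le\phi(r)+C$ on $(0,1]$ for some constant $C$; for example, $\phi(r)=\log\log\log(1/r)$ is such a function. Then $\mathcal H^{h_1}(E_{\{M_n\}})>0$ for $h_1(r)=r^2\log(1/r)\phi(r)$, provided that $\{M_n\}$ grows sufficiently fast; that is, there is a function $g:\mathbb N\to\mathbb N$, depending only on $\phi$, such that this holds whenever $M_{n+1}\ge g(M_n)$ for all sufficiently large $n$. (4) In particular, there is a strictly increasing such sequence $\{M_n\}$ for which the Besicovitch set $E=E_{\{M_n\}}$ satisfies $\mathcal H^{h}(E)<\infty$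 for $h(r)=r^2\log(1/r)$, and $\mathcal H^{h}(E)=\infty$ for $h(r)=r^2\log(1/r)(\log\log(1/r))^\varepsilon$ for every $\varepsilon>0$. -/

import Mathlib

noncomputable section

namespace Keich

open Filter Topology MeasureTheory Set

/-- The Euclidean plane. -/
abbrev Plane : Type := EuclideanSpace ℝ (Fin 2)

/-- The truncated logarithm `log R = max (log₂ R, 1)`. -/
def tlog (R : ℝ) : ℝ := max (Real.logb 2 R) 1

/-- A non-vertical line `y = a x + b`, recorded as the pair `(a, b)`. Addition and scalar
multiplication of pairs are those of the affine functions `x ↦ a x + b`. -/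
abbrev Line : Type := ℝ × ℝ

/-- The line of Schoenberg's compression of a triangle into `2 ^ M` thin triangles that belongs
to the binary digits `ε₁, …, ε_M`: slope `∑ εₖ / 2 ^ k`, intercept `-∑ (k - 1) / M * εₖ / 2 ^ k`.
The digit `εₖ` is `e (k - 1)`. -/
def schoenbergLine (M : ℕ) (e : Fin M → Fin 2) : Line :=
  (∑ k : Fin M, ((e k : ℕ) : ℝ) / 2 ^ ((k : ℕ) + 1),
    -∑ k : Fin M, (((k : ℕ) : ℝ) / (M : ℝ)) * (((e k : ℕ) : ℝ) / 2 ^ ((k : ℕ) + 1)))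

/-- The set of all `2 ^ M` lines of the compression. -/
def schoenbergLines (M : ℕ) : Set Line := range (schoenbergLine M)

/-- `δ_n = 2 ^ (-M₁) ⋯ 2 ^ (-M_n)`. The sequence `M₁, M₂, …` is indexed from `0`:
`M_{n + 1}` is `M n`. -/
def scale (M : ℕ → ℕ) (n : ℕ) : ℝ := ∏ i ∈ Finset.range n, ((2 : ℝ) ^ (M i))⁻¹

/-- The line sets of the iteration: the `0`-th one is `{0}`, and the `(n + 1)`-st one consists of
the lines `l + δ_n e` with `l` in the `n`-th one and `e` in the compression with parameter
`M_{n + 1}`. -/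
def iterLines (M : ℕ → ℕ) : ℕ → Set Line
  | 0 => {0}
  | n + 1 => {p | ∃ l ∈ iterLines M n, ∃ e ∈ schoenbergLines (M n), p = l + scale M n • e}

/-- The part in the strip `1/2 ≤ x ≤ 3/4` of the double triangle of width `δ` around a line. -/
def fan (δ : ℝ) (l : Line) : Set Plane :=
  {p | p 0 ∈ Icc (1 / 2 : ℝ) (3 / 4) ∧
    (l.1 * p 0 + l.2) + δ * (p 0 - 1) ≤ p 1 ∧ p 1 ≤ (l.1 * p 0 + l.2) + δ * p 0}

/-- The `n`-th Kakeya-type set of the iteration. -/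
def kakeyaSet (M : ℕ → ℕ) (n : ℕ) : Set Plane :=
  ⋃ l ∈ iterLines M n, fan (scale M n) l

/-- The limit set of the iteration. -/
def limitSet (M : ℕ → ℕ) : Set Plane := ⋂ n : ℕ, kakeyaSet M (n + 1)

/-- The admissible parameter sequences: `M_n = 2 ^ m_n` with positive integers `m_n`,
non-decreasing and tending to infinity. -/
structure IsParameter (M : ℕ → ℕ) : Prop where
  pow_two : ∀ n, ∃ k : ℕ, 0 < k ∧ M n = 2 ^ k
  mono : Monotone M
  tendsto : Tendsto M atTop atTop

/-- Besicovitch sets, normalized by rotation and dilation: compact null sets in the strip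
`1/2 ≤ x ≤ 3/4` that contain a segment `y = a x + b`, `1/2 ≤ x ≤ 3/4`, for every slope
`a ∈ [0, 1]`. -/
structure IsBesicovitch (E : Set Plane) : Prop where
  compact : IsCompact E
  subset_strip : ∀ p ∈ E, p 0 ∈ Icc (1 / 2 : ℝ) (3 / 4)
  null : volume E = 0
  segment : ∀ a ∈ Icc (0 : ℝ) 1, ∃ b : ℝ, ∀ x ∈ Icc (1 / 2 : ℝ) (3 / 4),
    (!₂[x, a * x + b] : Plane) ∈ E

/-- The Hausdorff measure in the plane with respect to a gauge function `h`
(only the values `h r` for small `r ≥ 0` matter). -/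
def gaugeMeasure (h : ℝ → ℝ) : Measure Plane :=
  Measure.mkMetric fun d => ENNReal.ofReal (h d.toReal)

/-- The gauge `r² log (1/r)`; it is `0` at `r = 0`. -/
def gauge (r : ℝ) : ℝ := r ^ 2 * tlog (1 / r)

/-- The hypotheses on the factor `φ`, a function on `(0, 1]`. -/
structure IsGaugeFactor (φ : ℝ → ℝ) : Prop where
  pos : ∀ r ∈ Ioc (0 : ℝ) 1, 0 < φ r
  anti : AntitoneOn φ (Ioc 0 1)
  tendsto : Tendsto φ (𝓝[>] 0) atTop
  lt_log : ∀ᶠ r in 𝓝[>] (0 : ℝ), φ r < tlog (1 / r)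
  doubling : ∃ C : ℝ, ∀ r ∈ Ioc (0 : ℝ) 1, φ (r ^ 2) ≤ φ r + C

end Keich

end

noncomputable section

namespace Keich

open Filter Topology MeasureTheory Set

/-! Blocks are indexed from `0`: `M_n` is the length of block `n`, `S_n` the number of digits before
it, and `δ_n = 2 ^ (-S_n)`. A digit sequence selects a nested sequence of fans, which shrink to a
line whose slope has these binary digits. So the limit set contains a segment of every slope in `[0,
1]`.

Upper bound. Digit `k` of a block contributes `2 ^ (-(k + 1)) * (x - k / M_n)`, a rotation about `x
= k / M_n`. Over `[k / M_n, (k + 1) / M_n]` the digits just after `k` hardly matter, and all lines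
sharing the first `S_n + k` digits stay within a constant times `ρ = 2 ^ (-(S_n + k)) / M_n` of each
other. Cutting these strips into pieces of width `ρ` leaves `4 ^ (S_n + k)` pieces of diameter at
most `8 ρ`. Summed over `k`, the squares `ρ ^ 2` give `1 / M_n`: hence measure zero, and finite
measure for `r² log (1/r)`, since `log (1/ρ)` is at most `3 M_n` once `S_n ≤ M_n`.

Lower bound. Lebesgue measure in `(x, a)` is pushed to the limit set by `graphPoint`. Two lines of
slopes `a`, `a'` are `δ`-close only over an `x`-interval of length at most `2 δ / |a - a'|`, so on
average a point has about `δ log (1/δ)` parameters of lines within `δ`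
(`lintegral_volume_nearSet_le`). By Chebyshev and Borel–Cantelli, almost every point exceeds this
average at scale `δ_n` by at most a factor `K_n`, for all large `n`, provided `∑ 1 / K_n` converges.
Only the sparse scales `δ_n` are charged: for `r` in the first quarter of a block the lines of one
prefix separate linearly, and the bound at `δ_n` carries over (`volume_near_le_of_coarse`); for
smaller `r`, `log (1/r)` is already comparable to `S_{n+1}`, and the bound at `δ_{n+1}` suffices
(`volume_near_le_of_fine`). If the `M_n` grow fast, `K_n` stays below `φ`, and the mass distribution
principle gives positive measure. -/

/-- The value at `x` of the affine function given by a line. -/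
def Line.eval (l : Line) (x : ℝ) : ℝ := l.1 * x + l.2

lemma Line.eval_add (l m : Line) (x : ℝ) : (l + m).eval x = l.eval x + m.eval x := by
  simp only [Line.eval, Prod.fst_add, Prod.snd_add]; ring

lemma Line.eval_smul (c : ℝ) (l : Line) (x : ℝ) : (c • l).eval x = c * l.eval x := by
  simp only [Line.eval, Prod.smul_fst, Prod.smul_snd, smul_eq_mul]; ring

/-! ### Binary digit sequences and the lines of the iteration -/

/-- The number of binary digits that determine a line of the `n`-th iteration. -/
def offset (M : ℕ → ℕ) (n : ℕ) : ℕ := ∑ i ∈ Finset.range n, M i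

lemma offset_succ (M : ℕ → ℕ) (n : ℕ) : offset M (n + 1) = offset M n + M n :=
  Finset.sum_range_succ _ _

lemma offset_mono (M : ℕ → ℕ) : Monotone (offset M) :=
  monotone_nat_of_le_succ fun n => by rw [offset_succ]; omega

lemma scale_eq (M : ℕ → ℕ) (n : ℕ) : scale M n = ((2 : ℝ) ^ offset M n)⁻¹ := by
  rw [scale, offset, ← Finset.prod_pow_eq_pow_sum, Finset.prod_inv_distrib]

lemma scale_pos (M : ℕ → ℕ) (n : ℕ) : 0 < scale M n := by
  rw [scale_eq]; positivity

lemma scale_zero (M : ℕ → ℕ) : scale M 0 = 1 := by simp [scale]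

lemma scale_succ (M : ℕ → ℕ) (n : ℕ) : scale M (n + 1) = scale M n * ((2 : ℝ) ^ M n)⁻¹ :=
  Finset.prod_range_succ _ _

lemma scale_antitone (M : ℕ → ℕ) : Antitone (scale M) := by
  intro m n h
  rw [scale_eq, scale_eq]
  exact inv_anti₀ (by positivity) (pow_le_pow_right₀ (by norm_num) (offset_mono M h))

/-- The `n`-th block of a sequence of binary digits. -/
def block (M : ℕ → ℕ) (d : ℕ → Fin 2) (n : ℕ) : Fin (M n) → Fin 2 := fun k => d (offset M n + k)

/-- The line of the `n`-th iteration that belongs to a sequence of binary digits. -/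
def digitLine (M : ℕ → ℕ) (d : ℕ → Fin 2) (n : ℕ) : Line :=
  ∑ i ∈ Finset.range n, scale M i • schoenbergLine (M i) (block M d i)

lemma digitLine_succ (M : ℕ → ℕ) (d : ℕ → Fin 2) (n : ℕ) :
    digitLine M d (n + 1) =
      digitLine M d n + scale M n • schoenbergLine (M n) (block M d n) :=
  Finset.sum_range_succ _ _

lemma digitLine_congr {M : ℕ → ℕ} {d d' : ℕ → Fin 2} {n : ℕ}
    (h : ∀ i < offset M n, d i = d' i) : digitLine M d n = digitLine M d' n := by
  refine Finset.sum_congr rfl fun i hi => ?_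
  have hi' : offset M (i + 1) ≤ offset M n := offset_mono M (by simpa using hi)
  have : block M d i = block M d' i := by
    funext k
    refine h _ (lt_of_lt_of_le ?_ hi')
    rw [offset_succ]
    exact Nat.add_lt_add_left k.2 _
  rw [this]

lemma iterLines_eq_range (M : ℕ → ℕ) (n : ℕ) :
    iterLines M n = range fun d : ℕ → Fin 2 => digitLine M d n := by
  induction n with
  | zero => simp [iterLines, digitLine, range_const]
  | succ n ih =>
    ext p
    simp only [iterLines, mem_ofPred_eq, ih, schoenbergLines, mem_range]
    constructor
    · rintro ⟨_, ⟨d, rfl⟩, _, ⟨e, rfl⟩, rfl⟩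
      let d' : ℕ → Fin 2 := fun i =>
        if i < offset M n then d i
        else if h : i - offset M n < M n then e ⟨i - offset M n, h⟩ else 0
      refine ⟨d', ?_⟩
      have h1 : digitLine M d' n = digitLine M d n :=
        digitLine_congr fun i hi => by simp [d', hi]
      have h2 : block M d' n = e := by
        funext k
        simp [d', block]
      rw [digitLine_succ, h1, h2]
    · rintro ⟨d, rfl⟩
      exact ⟨_, ⟨d, rfl⟩, _, ⟨block M d n, rfl⟩, digitLine_succ M d n⟩

lemma iterLines_finite (M : ℕ → ℕ) (n : ℕ) : (iterLines M n).Finite := by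
  induction n with
  | zero => exact finite_singleton _
  | succ n ih =>
    have : iterLines M (n + 1) =
        image2 (fun l e => l + scale M n • e) (iterLines M n) (schoenbergLines (M n)) := by
      ext p
      simp only [iterLines, mem_ofPred_eq, mem_image2]
      constructor
      · rintro ⟨l, hl, e, he, rfl⟩
        exact ⟨l, hl, e, he, rfl⟩
      · rintro ⟨l, hl, e, he, rfl⟩
        exact ⟨l, hl, e, he, rfl⟩
    rw [this]
    exact ih.image2 _ (finite_range _)

/-- In this form each digit is a rotation about its own pivot `x = k / M`; the pivots sweep across
`[0, 1)`, which produces the compression. -/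
lemma eval_schoenbergLine (M : ℕ) (e : Fin M → Fin 2) (x : ℝ) :
    (schoenbergLine M e).eval x =
      ∑ k : Fin M, ((e k : ℕ) : ℝ) / 2 ^ ((k : ℕ) + 1) * (x - (k : ℕ) / (M : ℝ)) := by
  simp only [schoenbergLine, Line.eval, Finset.sum_mul, ← sub_eq_add_neg,
    ← Finset.sum_sub_distrib]
  exact Finset.sum_congr rfl fun k _ => by ring

lemma sum_range_two_pow_inv (a N : ℕ) :
    ∑ k ∈ Finset.range N, (1 : ℝ) / 2 ^ (a + k + 1) = ((2 : ℝ) ^ a)⁻¹ - ((2 : ℝ) ^ (a + N))⁻¹ := by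
  induction N with
  | zero => simp
  | succ N ih => rw [Finset.sum_range_succ, ih, ← add_assoc, pow_succ]; field_simp; ring

lemma digit_nonneg (e : Fin 2) : (0 : ℝ) ≤ ((e : ℕ) : ℝ) := Nat.cast_nonneg _

lemma digit_le_one (e : Fin 2) : ((e : ℕ) : ℝ) ≤ 1 := by
  have : (e : ℕ) ≤ 1 := by omega
  exact_mod_cast this

/-- Each factor `x - k / M` lies between `x - 1` and `x`. Together with `le_eval_schoenbergLine`
this makes the fans of one digit sequence nested; the factor `1 - 2 ^ (-M)` lets the estimate
telescope over blocks to `scale M n - scale M m`. -/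
lemma eval_schoenbergLine_le (M : ℕ) (e : Fin M → Fin 2) {x : ℝ} (hx : 0 ≤ x) :
    (schoenbergLine M e).eval x ≤ (1 - ((2 : ℝ) ^ M)⁻¹) * x := by
  have := sum_range_two_pow_inv 0 M
  simp only [zero_add, pow_zero, inv_one] at this
  rw [eval_schoenbergLine, ← this, Finset.sum_mul,
    Finset.sum_range fun k => (1 : ℝ) / 2 ^ (k + 1) * x]
  refine Finset.sum_le_sum fun k _ => ?_
  have h1 : (0 : ℝ) ≤ (k : ℕ) / (M : ℝ) := by positivity
  have h2 := digit_nonneg (e k)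
  have h3 := digit_le_one (e k)
  rw [div_mul_eq_mul_div, div_mul_eq_mul_div]
  refine div_le_div_of_nonneg_right ?_ (by positivity)
  nlinarith

lemma le_eval_schoenbergLine (M : ℕ) (e : Fin M → Fin 2) {x : ℝ} (hx : x ≤ 1) :
    (1 - ((2 : ℝ) ^ M)⁻¹) * (x - 1) ≤ (schoenbergLine M e).eval x := by
  have := sum_range_two_pow_inv 0 M
  simp only [zero_add, pow_zero, inv_one] at this
  rw [eval_schoenbergLine, ← this, Finset.sum_mul,
    Finset.sum_range fun k => (1 : ℝ) / 2 ^ (k + 1) * (x - 1)]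
  refine Finset.sum_le_sum fun k _ => ?_
  have hM : (0 : ℝ) < M := by exact_mod_cast lt_of_le_of_lt (Nat.zero_le _) k.2
  have h1 : ((k : ℕ) : ℝ) / (M : ℝ) ≤ 1 := by
    rw [div_le_one hM]; exact_mod_cast k.2.le
  have h2 := digit_nonneg (e k)
  have h3 := digit_le_one (e k)
  rw [div_mul_eq_mul_div, div_mul_eq_mul_div]
  refine div_le_div_of_nonneg_right ?_ (by positivity)
  nlinarith

lemma eval_digitLine_sub_le (M : ℕ → ℕ) (d : ℕ → Fin 2) {n m : ℕ} (h : n ≤ m) {x : ℝ}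
    (hx : 0 ≤ x) :
    (digitLine M d m).eval x - (digitLine M d n).eval x ≤ (scale M n - scale M m) * x := by
  induction m, h using Nat.le_induction with
  | base => simp
  | succ m _ ih =>
    rw [digitLine_succ, Line.eval_add, Line.eval_smul, scale_succ]
    have := mul_le_mul_of_nonneg_left (eval_schoenbergLine_le (M m) (block M d m) hx)
      (scale_pos M m).le
    linarith

lemma le_eval_digitLine_sub (M : ℕ → ℕ) (d : ℕ → Fin 2) {n m : ℕ} (h : n ≤ m) {x : ℝ}
    (hx : x ≤ 1) :
    (scale M n - scale M m) * (x - 1) ≤ (digitLine M d m).eval x - (digitLine M d n).eval x := by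
  induction m, h using Nat.le_induction with
  | base => simp
  | succ m _ ih =>
    rw [digitLine_succ, Line.eval_add, Line.eval_smul, scale_succ]
    have := mul_le_mul_of_nonneg_left (le_eval_schoenbergLine (M m) (block M d m) hx)
      (scale_pos M m).le
    linarith

lemma IsParameter.two_le {M : ℕ → ℕ} (hM : IsParameter M) (n : ℕ) : 2 ≤ M n := by
  obtain ⟨k, hk, h⟩ := hM.pow_two n
  rw [h]
  exact Nat.le_self_pow hk.ne' 2

lemma IsParameter.le_offset {M : ℕ → ℕ} (hM : IsParameter M) (n : ℕ) : n ≤ offset M n := by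
  induction n with
  | zero => simp
  | succ n ih => rw [offset_succ]; have := hM.two_le n; omega

lemma IsParameter.offset_tendsto {M : ℕ → ℕ} (hM : IsParameter M) :
    Tendsto (offset M) atTop atTop :=
  tendsto_atTop_mono hM.le_offset tendsto_id

lemma IsParameter.scale_tendsto {M : ℕ → ℕ} (hM : IsParameter M) :
    Tendsto (scale M) atTop (𝓝 0) := by
  have h := (tendsto_pow_atTop_nhds_zero_of_lt_one (r := (2 : ℝ)⁻¹) (by norm_num)
    (by norm_num)).comp hM.offset_tendsto
  refine h.congr fun n => ?_
  simp [scale_eq]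

/-! ### Limit lines and their segments -/

/-- The limit of the lines of a sequence of binary digits. -/
def limitLine (M : ℕ → ℕ) (d : ℕ → Fin 2) : Line :=
  (Real.ofDigits d, ∑' i, scale M i * (schoenbergLine (M i) (block M d i)).2)

lemma digitLine_fst (M : ℕ → ℕ) (d : ℕ → Fin 2) (n : ℕ) :
    (digitLine M d n).1 = ∑ i ∈ Finset.range (offset M n), Real.ofDigitsTerm d i := by
  induction n with
  | zero => simp [digitLine, offset]
  | succ n ih =>
    rw [digitLine_succ, Prod.fst_add, ih, offset_succ, Finset.sum_range_add]
    congr 1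
    rw [Finset.sum_range fun k => Real.ofDigitsTerm d (offset M n + k)]
    simp only [Prod.smul_fst, schoenbergLine, smul_eq_mul, Finset.mul_sum]
    refine Finset.sum_congr rfl fun k _ => ?_
    rw [scale_eq, Real.ofDigitsTerm, block, add_assoc, pow_add]
    push_cast
    field_simp
    ring

lemma abs_schoenbergLine_snd_le (M : ℕ) (e : Fin M → Fin 2) : |(schoenbergLine M e).2| ≤ 1 := by
  have h1 := eval_schoenbergLine_le M e (x := 0) le_rfl
  have h2 := le_eval_schoenbergLine M e (x := 0) zero_le_one
  have h3 : (0 : ℝ) < ((2 : ℝ) ^ M)⁻¹ := by positivity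
  simp only [Line.eval, mul_zero, zero_add] at h1 h2
  rw [abs_le]
  constructor <;> linarith

lemma IsParameter.summable_scale {M : ℕ → ℕ} (hM : IsParameter M) : Summable (scale M) := by
  refine Summable.of_nonneg_of_le (fun n => (scale_pos M n).le) (fun n => ?_)
    (summable_geometric_of_lt_one (r := (2 : ℝ)⁻¹) (by norm_num) (by norm_num))
  rw [scale_eq, inv_pow]
  exact inv_anti₀ (by positivity) (pow_le_pow_right₀ (by norm_num) (hM.le_offset n))

lemma IsParameter.digitLine_tendsto {M : ℕ → ℕ} (hM : IsParameter M) (d : ℕ → Fin 2) :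
    Tendsto (digitLine M d) atTop (𝓝 (limitLine M d)) := by
  refine Tendsto.prodMk_nhds ?_ ?_ |>.congr fun n => (Prod.mk.eta (p := digitLine M d n))
  · simp only [digitLine_fst]
    exact (Real.summable_ofDigitsTerm.hasSum.tendsto_sum_nat).comp hM.offset_tendsto
  · have hs : Summable fun i => scale M i * (schoenbergLine (M i) (block M d i)).2 := by
      refine Summable.of_norm_bounded hM.summable_scale fun i => ?_
      rw [norm_mul, Real.norm_eq_abs, Real.norm_eq_abs, abs_of_pos (scale_pos M i)]
      exact mul_le_of_le_one_right (scale_pos M i).le (abs_schoenbergLine_snd_le _ _)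
    refine hs.hasSum.tendsto_sum_nat.congr fun n => ?_
    simp [digitLine, Prod.snd_sum]

lemma IsParameter.eval_tendsto {M : ℕ → ℕ} (hM : IsParameter M) (d : ℕ → Fin 2) (x : ℝ) :
    Tendsto (fun n => (digitLine M d n).eval x) atTop (𝓝 ((limitLine M d).eval x)) := by
  have h : Continuous fun l : Line => l.eval x := by unfold Line.eval; fun_prop
  exact (h.tendsto _).comp (hM.digitLine_tendsto d)

lemma IsParameter.eval_limitLine_sub_le {M : ℕ → ℕ} (hM : IsParameter M) (d : ℕ → Fin 2) (n : ℕ)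
    {x : ℝ} (hx : 0 ≤ x) :
    (limitLine M d).eval x - (digitLine M d n).eval x ≤ scale M n * x := by
  refine le_of_tendsto ((hM.eval_tendsto d x).sub_const _) ?_
  filter_upwards [eventually_ge_atTop n] with m hm
  refine (eval_digitLine_sub_le M d hm hx).trans ?_
  have := scale_pos M m
  nlinarith

lemma IsParameter.le_eval_limitLine_sub {M : ℕ → ℕ} (hM : IsParameter M) (d : ℕ → Fin 2) (n : ℕ)
    {x : ℝ} (hx : x ≤ 1) :
    scale M n * (x - 1) ≤ (limitLine M d).eval x - (digitLine M d n).eval x := by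
  refine ge_of_tendsto ((hM.eval_tendsto d x).sub_const _) ?_
  filter_upwards [eventually_ge_atTop n] with m hm
  refine le_trans ?_ (le_eval_digitLine_sub M d hm hx)
  have := scale_pos M m
  nlinarith

lemma IsParameter.mem_limitSet {M : ℕ → ℕ} (hM : IsParameter M) (d : ℕ → Fin 2) {x : ℝ}
    (hx : x ∈ Icc (1 / 2 : ℝ) (3 / 4)) :
    (!₂[x, (limitLine M d).eval x] : Plane) ∈ limitSet M := by
  refine mem_iInter.2 fun n => mem_iUnion₂.2 ⟨digitLine M d (n + 1), ?_, ?_⟩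
  · rw [iterLines_eq_range]; exact ⟨d, rfl⟩
  · have h1 := hM.eval_limitLine_sub_le d (n + 1) (x := x) (by linarith [hx.1])
    have h2 := hM.le_eval_limitLine_sub d (n + 1) (x := x) (by linarith [hx.2])
    refine ⟨by simpa using hx, ?_, ?_⟩
    · change (digitLine M d (n + 1)).eval x + _ ≤ (limitLine M d).eval x
      simp
      linarith
    · change (limitLine M d).eval x ≤ (digitLine M d (n + 1)).eval x + _
      simp
      linarith

/-! ### Compactness and elementary plane geometry -/

lemma fan_isCompact (δ : ℝ) (l : Line) : IsCompact (fan δ l) := by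
  have : fan δ l ⊆ (fun q : ℝ × ℝ => (!₂[q.1, l.eval q.1 + δ * (q.1 - 1) + q.2] : Plane)) ''
      (Icc (1 / 2) (3 / 4) ×ˢ Icc 0 δ) := by
    rintro p ⟨h0, h1, h2⟩
    refine ⟨(p 0, p 1 - (l.eval (p 0) + δ * (p 0 - 1))), ⟨h0, ?_, ?_⟩, ?_⟩
    · simp only [Line.eval]; linarith
    · simp only [Line.eval]; linarith
    · ext i
      fin_cases i <;> simp
  refine IsCompact.of_isClosed_subset ((isCompact_Icc.prod isCompact_Icc).image ?_) ?_ this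
  · unfold Line.eval; fun_prop
  · have h0 : Continuous fun p : Plane => p 0 := by fun_prop
    have h1 : Continuous fun p : Plane => p 1 := by fun_prop
    exact (isClosed_Icc.preimage h0).inter
      ((isClosed_le (by fun_prop) h1).inter (isClosed_le h1 (by fun_prop)))

lemma kakeyaSet_isCompact (M : ℕ → ℕ) (n : ℕ) : IsCompact (kakeyaSet M n) :=
  (iterLines_finite M n).isCompact_biUnion fun l _ => fan_isCompact _ l

lemma limitSet_isCompact (M : ℕ → ℕ) : IsCompact (limitSet M) :=
  (kakeyaSet_isCompact M 1).of_isClosed_subset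
    (isClosed_iInter fun n => (kakeyaSet_isCompact M (n + 1)).isClosed)
    (iInter_subset _ 0)

lemma plane_dist_le (p q : Plane) : dist p q ≤ |p 0 - q 0| + |p 1 - q 1| := by
  rw [EuclideanSpace.dist_eq, Fin.sum_univ_two, Real.dist_eq, Real.dist_eq]
  refine Real.sqrt_le_iff.2 ⟨by positivity, ?_⟩
  nlinarith [abs_nonneg (p 0 - q 0), abs_nonneg (p 1 - q 1)]

lemma plane_abs_sub_le (p q : Plane) (i : Fin 2) : |p i - q i| ≤ dist p q := by
  rw [dist_eq_norm, ← Real.norm_eq_abs]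
  exact PiLp.norm_apply_le (p - q) i

lemma digitLine_fst_mem (M : ℕ → ℕ) (d : ℕ → Fin 2) (n : ℕ) :
    (digitLine M d n).1 ∈ Icc (0 : ℝ) 1 := by
  rw [digitLine_fst]
  exact ⟨Finset.sum_nonneg fun _ _ => Real.ofDigitsTerm_nonneg,
    (Real.summable_ofDigitsTerm.sum_le_tsum _ fun _ _ => Real.ofDigitsTerm_nonneg).trans
      (Real.ofDigits_le_one d)⟩

lemma Line.abs_eval_sub_le {l : Line} (hl : l.1 ∈ Icc (0 : ℝ) 1) (x y : ℝ) :
    |l.eval x - l.eval y| ≤ |x - y| := by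
  have : l.eval x - l.eval y = l.1 * (x - y) := by simp only [Line.eval]; ring
  rw [this, abs_mul, abs_of_nonneg hl.1]
  exact mul_le_of_le_one_left (abs_nonneg _) hl.2

/-! ### Efficient coverings and measure zero -/

/-- The digit sequence that continues a finite one by zeros. -/
def extendZero {N : ℕ} (e : Fin N → Fin 2) (i : ℕ) : Fin 2 := if h : i < N then e ⟨i, h⟩ else 0

/-- The side length of the pieces that cover the part of the set near `x = k / M n`. -/
def pieceSize (M : ℕ → ℕ) (n k : ℕ) : ℝ := ((2 : ℝ) ^ (offset M n + k) * M n)⁻¹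

/-- A piece of the covering of the part near `x = k / M n` of an iteration, around the line with
leading digits `e`. -/
def coverPiece (M : ℕ → ℕ) (n k : ℕ) (e : Fin (offset M n + k) → Fin 2) (i : ℕ) : Set Plane :=
  {p | p 0 ∈ Icc ((k : ℝ) / M n + i * pieceSize M n k) (k / M n + (i + 1) * pieceSize M n k) ∧
    |p 1 - (digitLine M (extendZero e) (n + 1)).eval (p 0)| ≤ 3 * pieceSize M n k}

lemma coverPiece_dist_le {M : ℕ → ℕ} {n k : ℕ} {e : Fin (offset M n + k) → Fin 2} {i : ℕ}
    {p q : Plane} (hp : p ∈ coverPiece M n k e i) (hq : q ∈ coverPiece M n k e i) :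
    dist p q ≤ 8 * pieceSize M n k := by
  have h0 : |p 0 - q 0| ≤ pieceSize M n k := by
    rw [abs_le]
    constructor <;> nlinarith [hp.1.1, hp.1.2, hq.1.1, hq.1.2]
  have h1 := (Line.abs_eval_sub_le (digitLine_fst_mem M (extendZero e) (n + 1)) (p 0) (q 0)).trans
    h0
  have h2 := hp.2
  have h3 := hq.2
  have h4 := plane_dist_le p q
  have h5 : |p 1 - q 1| ≤ 7 * pieceSize M n k := by
    rw [abs_le] at *
    constructor <;> linarith
  linarith

lemma sum_range_succ_div_two_pow_le (N : ℕ) :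
    ∑ i ∈ Finset.range N, ((i : ℝ) + 1) / 2 ^ (i + 1) ≤ 2 := by
  have : ∑ i ∈ Finset.range N, ((i : ℝ) + 1) / 2 ^ (i + 1) = 2 - (N + 2) / 2 ^ N := by
    induction N with
    | zero => simp
    | succ N ih => rw [Finset.sum_range_succ, ih, pow_succ]; push_cast; field_simp; ring
  rw [this]
  have : (0 : ℝ) ≤ (N + 2) / 2 ^ N := by positivity
  linarith

/-- Only the digits `j ≥ k` differ, and there `|x - j / M| ≤ (j - k + 1) / M`. The weights `2 ^ (-(j
+ 1))` make `∑ (i + 1) / 2 ^ (i + 1) ≤ 2` the constant. The gain over the trivial bound `2 ^ (-k)`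
is the factor `1 / M`. -/
lemma abs_eval_schoenbergLine_sub_le {M k : ℕ} (hk : k < M) {e e' : Fin M → Fin 2}
    (h : ∀ j : Fin M, (j : ℕ) < k → e j = e' j) {x : ℝ}
    (hx : x ∈ Icc ((k : ℝ) / M) ((k + 1) / M)) :
    |(schoenbergLine M e).eval x - (schoenbergLine M e').eval x| ≤ 2 * ((2 : ℝ) ^ k * M)⁻¹ := by
  have hM : (0 : ℝ) < M := by exact_mod_cast lt_of_le_of_lt (Nat.zero_le _) hk
  let g : ℕ → ℝ := fun j => if j < k then 0 else ((j : ℝ) - k + 1) / (2 ^ (j + 1) * M)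
  rw [eval_schoenbergLine, eval_schoenbergLine, ← Finset.sum_sub_distrib]
  calc _ ≤ ∑ j : Fin M, g j := by
        refine (Finset.abs_sum_le_sum_abs _ _).trans (Finset.sum_le_sum fun j _ => ?_)
        by_cases hj : (j : ℕ) < k
        · simp [g, hj, h j hj]
        · simp only [g, hj, if_false]
          have hj' : (k : ℝ) ≤ (j : ℕ) := by exact_mod_cast not_lt.1 hj
          have h1 : |x - (j : ℕ) / (M : ℝ)| ≤ ((j : ℕ) - (k : ℝ) + 1) / M := by
            have e1 : ((j : ℕ) - (k : ℝ) + 1) / M = (j : ℕ) / (M : ℝ) - k / M + 1 / M := by ring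
            have e2 : ((k : ℝ) + 1) / M = k / M + 1 / M := by ring
            have e3 : (k : ℝ) / M ≤ (j : ℕ) / M := by gcongr
            have e4 : 0 < 1 / (M : ℝ) := by positivity
            rw [e1, abs_le]
            rw [e2] at hx
            constructor <;> linarith [hx.1, hx.2]
          have h2 : |((e j : ℕ) : ℝ) - ((e' j : ℕ) : ℝ)| ≤ 1 := by
            rw [abs_le]
            constructor <;>
              linarith [digit_nonneg (e j), digit_nonneg (e' j), digit_le_one (e j),
                digit_le_one (e' j)]
          have e5 : ((e j : ℕ) : ℝ) / 2 ^ ((j : ℕ) + 1) * (x - (j : ℕ) / (M : ℝ)) -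
              ((e' j : ℕ) : ℝ) / 2 ^ ((j : ℕ) + 1) * (x - (j : ℕ) / (M : ℝ)) =
              (((e j : ℕ) : ℝ) - ((e' j : ℕ) : ℝ)) * (x - (j : ℕ) / (M : ℝ)) /
                2 ^ ((j : ℕ) + 1) := by ring
          rw [e5, abs_div, abs_mul, abs_of_pos (show (0 : ℝ) < 2 ^ ((j : ℕ) + 1) by positivity)]
          calc _ ≤ 1 * (((j : ℕ) - (k : ℝ) + 1) / M) / 2 ^ ((j : ℕ) + 1) := by gcongr
            _ = _ := by field_simp
    _ = ∑ j ∈ Finset.range M, g j := (Finset.sum_range g).symm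
    _ = ∑ i ∈ Finset.range (M - k), g (k + i) := by
        conv_lhs => rw [← Nat.add_sub_of_le hk.le, Finset.sum_range_add]
        rw [Finset.sum_eq_zero fun i hi => by simp [g, Finset.mem_range.1 hi], zero_add]
    _ = (∑ i ∈ Finset.range (M - k), ((i : ℝ) + 1) / 2 ^ (i + 1)) * ((2 : ℝ) ^ k * M)⁻¹ := by
        rw [Finset.sum_mul]
        refine Finset.sum_congr rfl fun i _ => ?_
        simp only [g, not_lt.2 (Nat.le_add_right k i), if_false]
        push_cast
        rw [add_assoc, pow_add]
        field_simp
        ring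
    _ ≤ _ := by
        gcongr
        exact sum_range_succ_div_two_pow_le _

lemma pieceSize_pos {M : ℕ → ℕ} (hM : IsParameter M) (n k : ℕ) : 0 < pieceSize M n k := by
  have : (0 : ℝ) < M n := by exact_mod_cast lt_of_lt_of_le two_pos (hM.two_le n)
  unfold pieceSize
  positivity

/-- The quarter of the block left over after digit `k` has `2 ^ (m - 2) ≥ m` digits, enough to
absorb the factor `2 ^ m`. -/
lemma mul_two_pow_le_two_pow {m k : ℕ} (hm : 4 ≤ m) (hk : 4 * k ≤ 3 * 2 ^ m) :
    2 ^ m * 2 ^ k ≤ 2 ^ 2 ^ m := by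
  rw [← pow_add]
  refine Nat.pow_le_pow_right two_pos ?_
  obtain ⟨a, rfl⟩ := Nat.exists_eq_add_of_le' (show 2 ≤ m by omega)
  have h : a + 2 ≤ 2 ^ a := by
    have ha : 2 ≤ a := by omega
    clear hm hk
    induction a, ha using Nat.le_induction with
    | base => norm_num
    | succ a ha ih => rw [pow_succ]; omega
  rw [pow_add] at *
  omega

lemma exists_mem_coverPiece {M : ℕ → ℕ} (hM : IsParameter M) {n : ℕ} (hn : 16 ≤ M n) {p : Plane}
    (hp : p ∈ kakeyaSet M (n + 1)) :
    ∃ k < M n, ∃ e : Fin (offset M n + k) → Fin 2, ∃ i < 2 ^ (offset M n + k),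
      p ∈ coverPiece M n k e i := by
  simp only [kakeyaSet, iterLines_eq_range, mem_iUnion, mem_range] at hp
  obtain ⟨_, ⟨d, rfl⟩, ⟨h0, h0'⟩, h1, h2⟩ := hp
  have hMpos : (0 : ℝ) < M n := by exact_mod_cast lt_of_lt_of_le two_pos (hM.two_le n)
  set k := ⌊p 0 * M n⌋₊ with hk
  have hk1 : (k : ℝ) ≤ p 0 * M n := Nat.floor_le (by positivity)
  have hk2 : p 0 * M n < k + 1 := Nat.lt_floor_add_one _
  have hk3 : (k : ℝ) ≤ 3 / 4 * M n := hk1.trans (by gcongr)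
  have hk4 : 4 * k ≤ 3 * M n := by
    have : (4 : ℝ) * k ≤ 3 * M n := by linarith
    exact_mod_cast this
  have hkM : k < M n := by omega
  have hx : p 0 ∈ Icc ((k : ℝ) / M n) ((k + 1) / M n) := by
    constructor
    · rwa [div_le_iff₀ hMpos]
    · rw [le_div_iff₀ hMpos]; exact hk2.le
  have hρ := pieceSize_pos hM n k
  let e : Fin (offset M n + k) → Fin 2 := fun i => d i
  refine ⟨k, hkM, e, ⌊(p 0 - k / M n) / pieceSize M n k⌋₊, ?_, ⟨?_, ?_⟩, ?_⟩
  · rw [Nat.floor_lt (div_nonneg (sub_nonneg.2 hx.1) hρ.le), div_lt_iff₀ hρ]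
    have : ((2 ^ (offset M n + k) : ℕ) : ℝ) * pieceSize M n k = 1 / M n := by
      rw [pieceSize]; push_cast; field_simp
    rw [this, sub_lt_iff_lt_add, ← add_div, lt_div_iff₀ hMpos]
    linarith
  · have := Nat.floor_le (div_nonneg (sub_nonneg.2 hx.1) hρ.le)
    rw [le_div_iff₀ hρ] at this
    linarith
  · have := Nat.lt_floor_add_one ((p 0 - k / M n) / pieceSize M n k)
    rw [div_lt_iff₀ hρ] at this
    linarith
  -- The `3` in `coverPiece` is `1 + 2`: the fan width, and the change of the line when its digits
  -- after the prefix are replaced by zeros.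
  · have a1 : |p 1 - (digitLine M d (n + 1)).eval (p 0)| ≤ scale M (n + 1) := by
      have := scale_pos M (n + 1)
      simp only [Line.eval]
      rw [abs_le]
      constructor <;> nlinarith
    -- This uses `x ≤ 3 / 4`: near `x = 1` the pieces would be thinner than the fans.
    have a2 : scale M (n + 1) ≤ pieceSize M n k := by
      rw [scale_succ, scale_eq, pieceSize, pow_add, ← mul_inv, mul_assoc]
      refine inv_anti₀ (by positivity) (mul_le_mul_of_nonneg_left ?_ (by positivity))
      obtain ⟨m, _, hm⟩ := hM.pow_two n
      rw [hm] at hn hk4 ⊢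
      have hm4 : 4 ≤ m := by
        by_contra! h
        have : 2 ^ m ≤ 2 ^ 3 := Nat.pow_le_pow_right two_pos (by omega)
        omega
      have := mul_two_pow_le_two_pow hm4 hk4
      rw [mul_comm]
      exact_mod_cast this
    have a3 : |(digitLine M d (n + 1)).eval (p 0) -
        (digitLine M (extendZero e) (n + 1)).eval (p 0)| ≤ 2 * pieceSize M n k := by
      have hc : digitLine M (extendZero e) n = digitLine M d n :=
        digitLine_congr fun i hi => by simp [extendZero, e, show i < offset M n + k by omega]
      rw [digitLine_succ, digitLine_succ, hc, Line.eval_add, Line.eval_add, Line.eval_smul,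
        Line.eval_smul, add_sub_add_left_eq_sub, ← mul_sub, abs_mul, abs_of_pos (scale_pos M n)]
      have := abs_eval_schoenbergLine_sub_le hkM (e := block M d n)
        (e' := block M (extendZero e) n) (fun j hj => by simp [block, extendZero, e, hj]) hx
      calc _ ≤ scale M n * (2 * ((2 : ℝ) ^ k * M n)⁻¹) := by
            gcongr
            exact (scale_pos M n).le
        _ = _ := by rw [scale_eq, pieceSize, pow_add]; field_simp
    have := abs_sub_le (p 1) ((digitLine M d (n + 1)).eval (p 0))
      ((digitLine M (extendZero e) (n + 1)).eval (p 0))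
    linarith

/-- The index type of the covering of an iteration. -/
abbrev CoverIndex (M : ℕ → ℕ) (n : ℕ) : Type :=
  Σ k : Fin (M n), (Fin (offset M n + k) → Fin 2) × Fin (2 ^ (offset M n + k))

/-- The covering of an iteration. -/
def cover (M : ℕ → ℕ) (n : ℕ) (i : CoverIndex M n) : Set Plane :=
  coverPiece M n i.1 i.2.1 i.2.2

lemma limitSet_subset_cover {M : ℕ → ℕ} (hM : IsParameter M) {n : ℕ} (hn : 16 ≤ M n) :
    limitSet M ⊆ ⋃ i, cover M n i := by
  intro p hp
  obtain ⟨k, hk, e, i, hi, h⟩ := exists_mem_coverPiece hM hn (mem_iInter.1 hp n)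
  exact mem_iUnion.2 ⟨⟨⟨k, hk⟩, e, ⟨i, hi⟩⟩, h⟩

lemma ediam_cover_le (M : ℕ → ℕ) (n : ℕ) (i : CoverIndex M n) :
    Metric.ediam (cover M n i) ≤ ENNReal.ofReal (8 * pieceSize M n i.1) := by
  refine Metric.ediam_le fun p hp q hq => ?_
  rw [edist_dist]
  exact ENNReal.ofReal_le_ofReal (coverPiece_dist_le hp hq)

/-- Every `k` has `2 ^ (S_n + k)` prefixes and as many pieces along each strip, so it contributes `c
/ M_n ^ 2` whatever its value. -/
lemma sum_pieceSize_sq {M : ℕ → ℕ} (hM : IsParameter M) (n : ℕ) {c : ℝ} (hc : 0 ≤ c) :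
    ∑ i : CoverIndex M n, ENNReal.ofReal (c * pieceSize M n i.1 ^ 2) =
      ENNReal.ofReal (c / M n) := by
  have hMpos : (0 : ℝ) < M n := by exact_mod_cast lt_of_lt_of_le two_pos (hM.two_le n)
  rw [← ENNReal.ofReal_sum_of_nonneg fun i _ => by positivity, Fintype.sum_sigma]
  congr 1
  have : ∀ k : Fin (M n), ∑ y : (Fin (offset M n + k) → Fin 2) × Fin (2 ^ (offset M n + k)),
      c * pieceSize M n k ^ 2 = c / (M n : ℝ) ^ 2 := by
    intro k
    simp only [Finset.sum_const, Finset.card_univ, Fintype.card_prod, Fintype.card_fun,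
      Fintype.card_fin, nsmul_eq_mul, pieceSize]
    push_cast
    field_simp
  simp only [this, Finset.sum_const, Finset.card_univ, Fintype.card_fin, nsmul_eq_mul]
  field_simp

lemma limitSet_null {M : ℕ → ℕ} (hM : IsParameter M) : volume (limitSet M) = 0 := by
  have hbound : ∀ᶠ n in atTop, volume (limitSet M) ≤ ENNReal.ofReal (64 * Real.pi / M n) := by
    filter_upwards [hM.tendsto.eventually_ge_atTop 16] with n hn
    calc volume (limitSet M) ≤ volume (⋃ i, cover M n i) :=
          measure_mono (limitSet_subset_cover hM hn)
      _ ≤ ∑ i, volume (cover M n i) := measure_iUnion_fintype_le _ _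
      _ ≤ ∑ i : CoverIndex M n, ENNReal.ofReal (64 * Real.pi * pieceSize M n i.1 ^ 2) := by
          refine Finset.sum_le_sum fun i _ => ?_
          rcases (cover M n i).eq_empty_or_nonempty with h | ⟨p, hp⟩
          · simp [h]
          · refine (measure_mono (t := Metric.closedBall p (8 * pieceSize M n i.1))
              fun q hq => coverPiece_dist_le hq hp).trans ?_
            have := (pieceSize_pos hM n i.1).le
            rw [EuclideanSpace.volume_closedBall_fin_two, ← ENNReal.ofReal_pow (by positivity),
              ← ENNReal.ofReal_mul (by positivity)]
            refine ENNReal.ofReal_le_ofReal (le_of_eq ?_)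
            ring
      _ = _ := sum_pieceSize_sq hM n (by positivity)
  have hlim : Tendsto (fun n => ENNReal.ofReal (64 * Real.pi / M n)) atTop (𝓝 0) := by
    rw [← ENNReal.ofReal_zero]
    exact ENNReal.tendsto_ofReal
      ((tendsto_natCast_atTop_atTop.comp hM.tendsto).const_div_atTop _)
  exact le_antisymm (ge_of_tendsto hlim hbound) zero_le

theorem isBesicovitch_limitSet {M : ℕ → ℕ} (hM : IsParameter M) :
    IsBesicovitch (limitSet M) where
  compact := limitSet_isCompact M
  subset_strip p hp := by
    obtain ⟨l, _, h⟩ := mem_iUnion₂.1 (mem_iInter.1 hp 0)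
    exact h.1
  null := limitSet_null hM
  segment a ha := by
    obtain ⟨d, _, hd⟩ := Real.ofDigits_SurjOn one_lt_two ha
    refine ⟨(limitLine M d).2, fun x hx => ?_⟩
    have := hM.mem_limitSet d hx
    rwa [Line.eval, show (limitLine M d).1 = a from hd] at this

/-! ### The gauge and the finite measure -/

lemma tlog_mono {r s : ℝ} (hr : 0 < r) (h : r ≤ s) : tlog r ≤ tlog s :=
  max_le_max (Real.logb_le_logb_of_le one_lt_two hr h) le_rfl

lemma one_le_tlog (r : ℝ) : 1 ≤ tlog r := le_max_right _ _

lemma tlog_mul_le {t s : ℝ} (ht : 1 ≤ t) (hs : 0 < s) :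
    tlog (t * s) ≤ Real.logb 2 t + tlog s := by
  have h : 0 ≤ Real.logb 2 t := Real.logb_nonneg one_lt_two ht
  refine max_le ?_ (by linarith [one_le_tlog s])
  rw [Real.logb_mul (by positivity) hs.ne']
  linarith [le_max_left (Real.logb 2 s) 1, show tlog s = max (Real.logb 2 s) 1 from rfl]

lemma tlog_two_pow {N : ℕ} (hN : 1 ≤ N) : tlog (2 ^ N) = N := by
  rw [tlog, Real.logb_pow, Real.logb_self_eq_one one_lt_two, mul_one]
  exact max_eq_left (by exact_mod_cast hN)

lemma logb_two_le_self {t : ℝ} (ht : 1 ≤ t) : Real.logb 2 t ≤ t := by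
  rw [Real.logb_le_iff_le_rpow one_lt_two (by positivity)]
  have h := one_add_mul_self_le_rpow_one_add (s := 1) (p := t) (by norm_num) ht
  norm_num at h
  linarith

lemma gauge_nonneg (r : ℝ) : 0 ≤ gauge r :=
  mul_nonneg (sq_nonneg r) (zero_le_one.trans (one_le_tlog _))

/-- Passing from `R` to `r` raises the logarithm by at most `R / r`, which the factor `r ^ 2`
absorbs. This allows the diameters of the pieces to be replaced by their upper bounds. -/
lemma gauge_le_two_mul_gauge {r R : ℝ} (hr : 0 ≤ r) (h : r ≤ R) : gauge r ≤ 2 * gauge R := by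
  rcases hr.eq_or_lt with rfl | hr
  · have := gauge_nonneg R
    simp only [gauge, ne_eq, OfNat.ofNat_ne_zero, not_false_eq_true, zero_pow, zero_mul] at *
    linarith
  have hR := hr.trans_le h
  have ht : 1 ≤ R / r := (one_le_div hr).2 h
  have e : 1 / r = R / r * (1 / R) := by field_simp
  have h1 := tlog_mul_le ht (one_div_pos.2 hR)
  rw [← e] at h1
  have h2 := logb_two_le_self ht
  have h3 := one_le_tlog (1 / R)
  have h4 : r ^ 2 * (R / r) ≤ R ^ 2 := by
    rw [sq, mul_assoc, mul_div_cancel₀ _ hr.ne']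
    nlinarith
  have h5 : r ^ 2 ≤ R ^ 2 := by gcongr
  simp only [gauge]
  nlinarith [sq_nonneg r, sq_nonneg R]

/-- With `M_n = 2 ^ m`, `log (1/ρ) = S_n + k + m ≤ 3 M_n`; the constant is `384 = 2 * 8 ^ 2 * 3`. -/
lemma gauge_pieceSize_le {M : ℕ → ℕ} (hM : IsParameter M) (n : ℕ) {k : ℕ} (hk : k < M n)
    (hS : offset M n ≤ M n) {r : ℝ} (hr : 0 ≤ r) (h : r ≤ 8 * pieceSize M n k) :
    gauge r ≤ 384 * M n * pieceSize M n k ^ 2 := by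
  have hρ := pieceSize_pos hM n k
  obtain ⟨m, hm0, hm⟩ := hM.pow_two n
  have h1 : tlog (1 / (8 * pieceSize M n k)) ≤ 3 * M n := by
    calc _ ≤ tlog (1 / pieceSize M n k) := by
          refine tlog_mono (by positivity) ?_
          gcongr
          linarith
      _ = tlog (2 ^ (offset M n + k + m)) := by
          rw [pieceSize, one_div, inv_inv, hm, pow_add _ _ m]
          push_cast
          rfl
      _ = ((offset M n + k + m : ℕ) : ℝ) := tlog_two_pow (by omega)
      _ ≤ ((3 * M n : ℕ) : ℝ) := by
          have : m < 2 ^ m := Nat.lt_two_pow_self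
          exact_mod_cast (by omega : offset M n + k + m ≤ 3 * M n)
      _ = _ := by push_cast; rfl
  have h2 := gauge_le_two_mul_gauge hr h
  have h3 : gauge (8 * pieceSize M n k) ≤ (8 * pieceSize M n k) ^ 2 * (3 * M n) :=
    mul_le_mul_of_nonneg_left h1 (sq_nonneg _)
  nlinarith

lemma IsParameter.two_mul_le {M : ℕ → ℕ} (hM : IsParameter M) {n : ℕ} (h : M n < M (n + 1)) :
    2 * M n ≤ M (n + 1) := by
  obtain ⟨a, _, ha⟩ := hM.pow_two n
  obtain ⟨b, _, hb⟩ := hM.pow_two (n + 1)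
  rw [ha, hb] at h ⊢
  rw [← pow_succ']
  exact Nat.pow_le_pow_right two_pos ((Nat.pow_lt_pow_iff_right one_lt_two).1 h)

/-- A strictly increasing sequence of powers of two at least doubles, so each term dominates the sum
of the earlier ones. -/
lemma offset_le_of_strictMono {M : ℕ → ℕ} (hM : IsParameter M) (h : StrictMono M) (n : ℕ) :
    offset M n ≤ M n := by
  induction n with
  | zero => simp [offset]
  | succ n ih =>
    have := hM.two_mul_le (h (Nat.lt_succ_self n))
    rw [offset_succ]
    omega

theorem gaugeMeasure_limitSet_lt_top {M : ℕ → ℕ} (hM : IsParameter M) (h : StrictMono M) :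
    gaugeMeasure gauge (limitSet M) < ⊤ := by
  have hn := hM.tendsto.eventually_ge_atTop 16
  have key := Measure.mkMetric_le_liminf_sum (limitSet M) (l := atTop)
    (fun n => ENNReal.ofReal (8 * scale M n)) (by
      rw [← ENNReal.ofReal_zero]
      refine ENNReal.tendsto_ofReal ?_
      simpa using hM.scale_tendsto.const_mul 8)
    (fun n => cover M n)
    (.of_forall fun n i => (ediam_cover_le M n i).trans (ENNReal.ofReal_le_ofReal (by
      have h1 : (1 : ℝ) ≤ M n := by exact_mod_cast one_le_two.trans (hM.two_le n)
      have h2 : (1 : ℝ) ≤ 2 ^ (i.1 : ℕ) := one_le_pow₀ one_le_two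
      rw [pieceSize, scale_eq, pow_add, mul_assoc]
      gcongr
      exact le_mul_of_one_le_right (by positivity) (one_le_mul_of_one_le_of_one_le h2 h1))))
    (hn.mono fun n hn => limitSet_subset_cover hM hn)
    (fun d => ENNReal.ofReal (gauge d.toReal))
  refine (key.trans (b := _) (c := ENNReal.ofReal 384) ?_).trans_lt ENNReal.ofReal_lt_top
  refine liminf_le_of_le (by isBoundedDefault) fun b hb => ?_
  obtain ⟨n, hn⟩ := hb.exists
  refine hn.trans ?_
  have hMpos : (0 : ℝ) < M n := by exact_mod_cast lt_of_lt_of_le two_pos (hM.two_le n)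
  calc _ ≤ ∑ i : CoverIndex M n, ENNReal.ofReal (384 * M n * pieceSize M n i.1 ^ 2) := by
        refine Finset.sum_le_sum fun i _ => ENNReal.ofReal_le_ofReal ?_
        refine gauge_pieceSize_le hM n i.1.2 (offset_le_of_strictMono hM h n)
          ENNReal.toReal_nonneg ?_
        exact ENNReal.toReal_le_of_le_ofReal (by linarith [pieceSize_pos hM n i.1])
          (ediam_cover_le M n i)
    _ = ENNReal.ofReal (384 * M n / M n) := sum_pieceSize_sq hM n (by positivity)
    _ = ENNReal.ofReal 384 := by rw [mul_div_cancel_right₀ _ hMpos.ne']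

/-! ### Parametrization by slope, and separation of limit lines -/

/-- The value at `x` of the limit line whose digits are the binary digits of `a`. -/
def graph (M : ℕ → ℕ) (x a : ℝ) : ℝ := (limitLine M (Real.digits a 2)).eval x

lemma measurable_graph {M : ℕ → ℕ} (hM : IsParameter M) :
    Measurable fun q : ℝ × ℝ => graph M q.1 q.2 := by
  have hdig : ∀ i, Measurable fun a : ℝ => ((Real.digits a 2 i : ℕ) : ℝ) := fun i => by
    have : Measurable fun a : ℝ => ⌊a * (2 : ℕ) ^ (i + 1)⌋₊ :=
      Nat.measurable_floor.comp (by fun_prop)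
    exact (measurable_from_top (f := fun m : ℕ => ((Fin.ofNat 2 m : ℕ) : ℝ))).comp this
  refine measurable_of_tendsto_metrizable
    (f := fun n (q : ℝ × ℝ) => (digitLine M (Real.digits q.2 2) n).eval q.1) (fun n => ?_)
    (tendsto_pi_nhds.2 fun q => hM.eval_tendsto _ _)
  induction n with
  | zero => simp [digitLine, Line.eval]
  | succ n ih =>
    simp only [digitLine_succ, Line.eval_add, Line.eval_smul, eval_schoenbergLine]
    refine ih.add (Measurable.const_mul (Finset.measurable_fun_sum _ fun k _ => ?_) _)
    exact (((hdig _).comp measurable_snd).div_const _).mul (measurable_fst.sub_const _)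

lemma graph_sub_graph (M : ℕ → ℕ) (x : ℝ) {a a' : ℝ} (ha : a ∈ Ico (0 : ℝ) 1)
    (ha' : a' ∈ Ico (0 : ℝ) 1) :
    graph M x a - graph M x a' = (a - a') * x +
      ((limitLine M (Real.digits a 2)).2 - (limitLine M (Real.digits a' 2)).2) := by
  simp only [graph, Line.eval, limitLine, Real.ofDigits_digits one_lt_two ha,
    Real.ofDigits_digits one_lt_two ha']
  ring

/-- The integer part of `2 ^ S * a` encodes the first `S` digits; equality of these integers thus
serves as the relation of having a common prefix. -/
lemma digits_eq_of_floor_eq {a a' : ℝ} {S : ℕ} (h : ⌊2 ^ S * a⌋₊ = ⌊2 ^ S * a'⌋₊) {i : ℕ}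
    (hi : i < S) : Real.digits a 2 i = Real.digits a' 2 i := by
  have key : ∀ b : ℝ, ⌊b * 2 ^ (i + 1)⌋₊ = ⌊2 ^ S * b⌋₊ / 2 ^ (S - (i + 1)) := fun b => by
    rw [← Nat.floor_div_natCast]
    congr 1
    push_cast
    rw [eq_div_iff (by positivity), mul_assoc, ← pow_add, Nat.add_sub_cancel' hi, mul_comm]
  simp only [Real.digits]
  push_cast
  rw [key, key, h]

lemma sum_ofDigitsTerm_digits {a : ℝ} (ha : a ∈ Ico (0 : ℝ) 1) (N : ℕ) :
    ∑ i ∈ Finset.range N, Real.ofDigitsTerm (Real.digits a 2) i = ⌊2 ^ N * a⌋₊ / 2 ^ N := by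
  have := Real.ofDigits_digits_sum_eq (b := 2) ha N
  push_cast at this
  rw [← this]
  field_simp

/-- Abel summation. The individual `u i`, differences of digits, have no sign; only their partial
sums do. -/
lemma mul_sum_le_sum_mul_of_antitone {w u : ℕ → ℝ} (hw : Antitone w)
    (hu : ∀ N, 0 ≤ ∑ i ∈ Finset.range N, u i) (N : ℕ) :
    w N * ∑ i ∈ Finset.range N, u i ≤ ∑ i ∈ Finset.range N, w i * u i := by
  induction N with
  | zero => simp
  | succ N ih =>
    calc _ ≤ w N * ∑ i ∈ Finset.range (N + 1), u i :=
          mul_le_mul_of_nonneg_right (hw N.le_succ) (hu _)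
      _ ≤ _ := by
          rw [Finset.sum_range_succ, Finset.sum_range_succ, mul_add]
          linarith

lemma abs_graph_sub_le_of_floor_eq {M : ℕ → ℕ} (hM : IsParameter M) {n : ℕ} {x a a' : ℝ}
    (hx : x ∈ Icc (0 : ℝ) 1) (h : ⌊2 ^ offset M n * a⌋₊ = ⌊2 ^ offset M n * a'⌋₊) :
    |graph M x a - graph M x a'| ≤ scale M n := by
  have hc : digitLine M (Real.digits a 2) n = digitLine M (Real.digits a' 2) n :=
    digitLine_congr fun i hi => digits_eq_of_floor_eq h hi
  have h1 := hM.eval_limitLine_sub_le (Real.digits a 2) n hx.1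
  have h2 := hM.le_eval_limitLine_sub (Real.digits a 2) n hx.2
  have h3 := hM.eval_limitLine_sub_le (Real.digits a' 2) n hx.1
  have h4 := hM.le_eval_limitLine_sub (Real.digits a' 2) n hx.2
  rw [hc] at h1 h2
  simp only [graph]
  rw [abs_le]
  constructor <;> linarith

/-- Limit lines with a common prefix separate linearly in their slopes, up to the scale of the
first quarter of the next block. -/
lemma sub_le_graph_sub {M : ℕ → ℕ} (hM : IsParameter M) {n : ℕ} {x a a' : ℝ}
    (hx : x ∈ Icc (1 / 2 : ℝ) (3 / 4)) (ha : a ∈ Ico (0 : ℝ) 1) (ha' : a' ∈ Ico (0 : ℝ) 1)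
    (h : ⌊2 ^ offset M n * a⌋₊ = ⌊2 ^ offset M n * a'⌋₊) (hle : a' ≤ a) :
    a - a' ≤ 4 * (graph M x a - graph M x a') + 9 * ((2 : ℝ) ^ (offset M n + M n / 4))⁻¹ := by
  have hMpos : (0 : ℝ) < M n := by exact_mod_cast lt_of_lt_of_le two_pos (hM.two_le n)
  set S := offset M n
  set Q := M n / 4
  have hQ : Q ≤ M n := Nat.div_le_self _ _
  let T : ℝ → ℕ → ℝ := fun b i => Real.ofDigitsTerm (Real.digits b 2) i
  let u : ℕ → ℝ := fun k => 2 ^ S * (T a (S + k) - T a' (S + k))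
  let w : ℕ → ℝ := fun k => x - k / M n
  have hT : ∀ i < S, T a i = T a' i := fun i hi => by
    simp only [T, Real.ofDigitsTerm, digits_eq_of_floor_eq h hi]
  have hsum : ∀ N, ∑ k ∈ Finset.range N, u k =
      2 ^ S * (∑ i ∈ Finset.range (S + N), T a i - ∑ i ∈ Finset.range (S + N), T a' i) := by
    intro N
    rw [Finset.sum_range_add, Finset.sum_range_add,
      Finset.sum_congr rfl fun i hi => hT i (Finset.mem_range.1 hi), add_sub_add_left_eq_sub,
      ← Finset.sum_sub_distrib, Finset.mul_sum]
  -- Truncating to finitely many digits is a floor, hence preserves the order of `a'` and `a`.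
  have hnonneg : ∀ N, 0 ≤ ∑ k ∈ Finset.range N, u k := by
    intro N
    rw [hsum, sum_ofDigitsTerm_digits ha, sum_ofDigitsTerm_digits ha', ← sub_div]
    have : (⌊2 ^ (S + N) * a'⌋₊ : ℝ) ≤ ⌊2 ^ (S + N) * a⌋₊ := by
      exact_mod_cast Nat.floor_mono (mul_le_mul_of_nonneg_left hle (by positivity))
    have := sub_nonneg.2 this
    positivity
  have hw : Antitone w := fun i j hij => by
    have : (i : ℝ) / M n ≤ j / M n := by gcongr
    simp only [w]
    linarith
  -- Over the strip `x ≥ 1 / 2`, so the pivots of the first quarter of the block are at distance at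
  -- least `1 / 4` to the left of `x`.
  have hwQ : 1 / 4 ≤ w Q := by
    have : (Q : ℝ) / M n ≤ 1 / 4 := by
      rw [div_le_iff₀ hMpos]
      have : 4 * Q ≤ M n := Nat.mul_div_le _ _
      have : (4 : ℝ) * Q ≤ M n := by exact_mod_cast this
      linarith
    simp only [w]
    linarith [hx.1]
  have habel := mul_sum_le_sum_mul_of_antitone hw hnonneg Q
  have hdiff : (schoenbergLine (M n) (block M (Real.digits a 2) n)).eval x -
      (schoenbergLine (M n) (block M (Real.digits a' 2) n)).eval x =
      ∑ k ∈ Finset.range (M n), w k * u k := by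
    rw [eval_schoenbergLine, eval_schoenbergLine, ← Finset.sum_sub_distrib,
      Finset.sum_range fun k => w k * u k]
    refine Finset.sum_congr rfl fun k _ => ?_
    simp only [w, u, T, Real.ofDigitsTerm, block]
    rw [add_assoc, pow_add]
    push_cast
    field_simp
    ring
  have htail : -((2 : ℝ) ^ Q)⁻¹ ≤ ∑ k ∈ Finset.range (M n - Q), w (Q + k) * u (Q + k) := by
    have h1 := sum_range_two_pow_inv Q (M n - Q)
    have h2 : (0 : ℝ) ≤ ((2 : ℝ) ^ (Q + (M n - Q)))⁻¹ := by positivity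
    calc _ ≤ -∑ k ∈ Finset.range (M n - Q), (1 : ℝ) / 2 ^ (Q + k + 1) := by rw [h1]; linarith
      _ = ∑ k ∈ Finset.range (M n - Q), -((1 : ℝ) / 2 ^ (Q + k + 1)) := by
          rw [Finset.sum_neg_distrib]
      _ ≤ _ := by
          refine Finset.sum_le_sum fun k hk => ?_
          have hk' : Q + k ≤ M n := by have := Finset.mem_range.1 hk; omega
          have hw1 : |w (Q + k)| ≤ 1 := by
            have e1 : ((Q + k : ℕ) : ℝ) / M n ≤ 1 := by
              rw [div_le_one hMpos]; exact_mod_cast hk'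
            have e2 : (0 : ℝ) ≤ ((Q + k : ℕ) : ℝ) / M n := by positivity
            simp only [w]
            rw [abs_le]
            constructor <;> linarith [hx.1, hx.2]
          have hu1 : |u (Q + k)| ≤ 1 / 2 ^ (Q + k + 1) := by
            have e : u (Q + k) = (((Real.digits a 2 (S + (Q + k)) : ℕ) : ℝ) -
                ((Real.digits a' 2 (S + (Q + k)) : ℕ) : ℝ)) / 2 ^ (Q + k + 1) := by
              simp only [u, T, Real.ofDigitsTerm]
              rw [add_assoc S, pow_add]
              push_cast
              field_simp
            rw [e, abs_div, abs_of_pos (show (0 : ℝ) < 2 ^ (Q + k + 1) by positivity)]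
            gcongr
            rw [abs_le]
            constructor <;>
              linarith [digit_nonneg (Real.digits a 2 (S + (Q + k))),
                digit_nonneg (Real.digits a' 2 (S + (Q + k))),
                digit_le_one (Real.digits a 2 (S + (Q + k))),
                digit_le_one (Real.digits a' 2 (S + (Q + k)))]
          have : |w (Q + k) * u (Q + k)| ≤ 1 / 2 ^ (Q + k + 1) := by
            rw [abs_mul]
            calc _ ≤ 1 * (1 / 2 ^ (Q + k + 1) : ℝ) :=
                  mul_le_mul hw1 hu1 (abs_nonneg _) zero_le_one
              _ = _ := one_mul _
          linarith [neg_abs_le (w (Q + k) * u (Q + k))]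
  set P := ∑ k ∈ Finset.range Q, u k with hP
  have hP0 : 0 ≤ P := hnonneg Q
  have hsplit : 1 / 4 * P - ((2 : ℝ) ^ Q)⁻¹ ≤ ∑ k ∈ Finset.range (M n), w k * u k := by
    rw [← Nat.add_sub_of_le hQ, Finset.sum_range_add]
    nlinarith
  have hc : digitLine M (Real.digits a 2) n = digitLine M (Real.digits a' 2) n :=
    digitLine_congr fun i hi => digits_eq_of_floor_eq h hi
  have h1 := hM.le_eval_limitLine_sub (Real.digits a 2) (n + 1) (x := x) (by linarith [hx.2])
  have h2 := hM.eval_limitLine_sub_le (Real.digits a' 2) (n + 1) (x := x) (by linarith [hx.1])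
  rw [digitLine_succ, Line.eval_add, Line.eval_smul] at h1 h2
  rw [hc] at h1
  have hs := scale_pos M n
  have hmain : scale M n * (1 / 4 * P - ((2 : ℝ) ^ Q)⁻¹) - scale M (n + 1) ≤
      graph M x a - graph M x a' := by
    rw [← hdiff] at hsplit
    have := mul_le_mul_of_nonneg_left hsplit hs.le
    simp only [graph]
    linarith
  have hs1 : scale M (n + 1) ≤ scale M n * ((2 : ℝ) ^ Q)⁻¹ := by
    rw [scale_succ]
    gcongr
    norm_num
  have hupper : a - a' ≤ scale M n * P + scale M n * ((2 : ℝ) ^ Q)⁻¹ := by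
    have e1 := Real.le_sum_ofDigitsTerm_digits (b := 2) ha (S + Q)
    have e2 := Real.sum_ofDigitsTerm_digits_le (b := 2) ha' (S + Q)
    rw [hP, hsum, scale_eq, inv_mul_cancel_left₀ (by positivity), ← mul_inv, ← pow_add]
    push_cast at e1
    rw [inv_pow] at e1
    linarith
  have hσ : ((2 : ℝ) ^ (S + Q))⁻¹ = scale M n * ((2 : ℝ) ^ Q)⁻¹ := by
    rw [scale_eq, ← mul_inv, ← pow_add]
  rw [hσ]
  -- The error `9` is `4 + 4 + 1`: the tail of the block and the later blocks, each multiplied by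
  -- `4`, and the truncation of `a - a'`.
  linarith

lemma abs_sub_le_graph_sub {M : ℕ → ℕ} (hM : IsParameter M) {n : ℕ} {x a a' : ℝ}
    (hx : x ∈ Icc (1 / 2 : ℝ) (3 / 4)) (ha : a ∈ Ico (0 : ℝ) 1) (ha' : a' ∈ Ico (0 : ℝ) 1)
    (h : ⌊2 ^ offset M n * a⌋₊ = ⌊2 ^ offset M n * a'⌋₊) :
    |a - a'| ≤ 4 * |graph M x a - graph M x a'| + 9 * ((2 : ℝ) ^ (offset M n + M n / 4))⁻¹ := by
  rcases le_total a' a with hle | hle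
  · rw [abs_of_nonneg (sub_nonneg.2 hle)]
    have := sub_le_graph_sub hM hx ha ha' h hle
    linarith [le_abs_self (graph M x a - graph M x a')]
  · rw [abs_of_nonpos (sub_nonpos.2 hle)]
    have := sub_le_graph_sub hM hx ha' ha h.symm hle
    linarith [neg_abs_le (graph M x a - graph M x a')]

/-! ### Transfer of bounds between scales -/

/-- The set of parameters of the limit lines that pass over `x` at a distance of at most `3 δ` of
the limit line of `a`. -/
def nearSet (M : ℕ → ℕ) (δ x a : ℝ) : Set ℝ :=
  {a' ∈ Ico (0 : ℝ) 1 | |graph M x a' - graph M x a| ≤ 3 * δ}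

/-- The set of points of `[0, 1)` with a given prefix of binary digits. -/
def prefixSet (S j : ℕ) : Set ℝ := {a ∈ Ico (0 : ℝ) 1 | ⌊2 ^ S * a⌋₊ = j}

lemma prefixSet_eq {S j : ℕ} (hj : j < 2 ^ S) :
    prefixSet S j = Ico ((j : ℝ) / 2 ^ S) ((j + 1) / 2 ^ S) := by
  ext a
  have h2 : (0 : ℝ) < 2 ^ S := by positivity
  have hj' : (j : ℝ) + 1 ≤ 2 ^ S := by exact_mod_cast hj
  simp only [prefixSet, mem_ofPred_eq, mem_Ico, div_le_iff₀ h2, lt_div_iff₀ h2]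
  constructor
  · rintro ⟨⟨h0, _⟩, h⟩
    rw [Nat.floor_eq_iff (by positivity)] at h
    constructor <;> linarith [h.1, h.2]
  · rintro ⟨h, h'⟩
    have h0 : 0 ≤ a := nonneg_of_mul_nonneg_left ((Nat.cast_nonneg j).trans h) h2
    refine ⟨⟨h0, ?_⟩, ?_⟩
    · by_contra! h1
      nlinarith
    · rw [Nat.floor_eq_iff (by positivity)]
      constructor <;> linarith

lemma volume_prefixSet {S j : ℕ} (hj : j < 2 ^ S) :
    volume (prefixSet S j) = ENNReal.ofReal ((2 : ℝ) ^ S)⁻¹ := by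
  rw [prefixSet_eq hj, Real.volume_Ico]
  congr 1
  field_simp
  ring

lemma measurableSet_prefixSet {S j : ℕ} (hj : j < 2 ^ S) : MeasurableSet (prefixSet S j) := by
  rw [prefixSet_eq hj]
  exact measurableSet_Ico

lemma volume_le_of_abs_sub_le {s : Set ℝ} {c : ℝ} (h : ∀ a ∈ s, ∀ b ∈ s, |a - b| ≤ c) :
    volume s ≤ ENNReal.ofReal c := by
  refine (Real.volume_le_diam s).trans (Metric.ediam_le fun a ha b hb => ?_)
  rw [edist_dist]
  exact ENNReal.ofReal_le_ofReal (h a ha b hb)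

/-- At scales in the first quarter of a block, a bound at the beginning of the block persists. -/
lemma volume_near_le_of_coarse {M : ℕ → ℕ} (hM : IsParameter M) {n : ℕ} {x a r K : ℝ}
    (hx : x ∈ Icc (1 / 2 : ℝ) (3 / 4)) (hK : 0 ≤ K)
    (hr : ((2 : ℝ) ^ (offset M n + M n / 4))⁻¹ ≤ r) (hr' : r ≤ scale M n)
    (h : volume (nearSet M (scale M n) x a) ≤ ENNReal.ofReal (K * scale M n)) :
    volume {a' ∈ Ico (0 : ℝ) 1 | |graph M x a' - graph M x a| ≤ 2 * r} ≤
      ENNReal.ofReal (25 * K * r) := by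
  classical
  have hr0 : 0 < r := lt_of_lt_of_le (by positivity) hr
  set S := offset M n
  set A := {a' ∈ Ico (0 : ℝ) 1 | |graph M x a' - graph M x a| ≤ 2 * r}
  let P := (Finset.range (2 ^ S)).filter fun j => (A ∩ prefixSet S j).Nonempty
  have hPlt : ∀ j ∈ P, j < 2 ^ S := fun j hj => Finset.mem_range.1 (Finset.mem_filter.1 hj).1
  have hcover : A ⊆ ⋃ j ∈ P, A ∩ prefixSet S j := by
    intro b hb
    have hmem : b ∈ A ∩ prefixSet S ⌊2 ^ S * b⌋₊ := ⟨hb, hb.1, rfl⟩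
    refine mem_iUnion₂.2 ⟨_, Finset.mem_filter.2 ⟨Finset.mem_range.2 ?_, ⟨b, hmem⟩⟩, hmem⟩
    rw [Nat.floor_lt (mul_nonneg (by positivity) hb.1.1)]
    push_cast
    have := hb.1.2
    have h2 : (0 : ℝ) < 2 ^ S := by positivity
    nlinarith
  have hpiece : ∀ j ∈ P, volume (A ∩ prefixSet S j) ≤ ENNReal.ofReal (25 * r) := by
    intro j _
    refine volume_le_of_abs_sub_le fun b hb c hc => ?_
    -- Two points of the piece have heights at most `4 * r` apart, so `25 = 4 * 4 + 9`.
    have h1 := abs_sub_le_graph_sub hM hx hb.1.1 hc.1.1 (hb.2.2.trans hc.2.2.symm)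
    have h2 : |graph M x b - graph M x c| ≤ 4 * r := by
      have := abs_sub_le (graph M x b) (graph M x a) (graph M x c)
      rw [abs_sub_comm (graph M x a)] at this
      linarith [hb.1.2, hc.1.2]
    linarith
  have hcard : (P.card : ℝ) ≤ K := by
    -- A prefix that meets `A` lies entirely in the near set: its lines are within `scale M n` of
    -- each other, and `scale M n + 2 * r ≤ 3 * scale M n`. This is why `nearSet` has the factor
    -- `3`. Comparing volumes then bounds the number of prefixes by `K`.
    have hsub : ⋃ j ∈ P, prefixSet S j ⊆ nearSet M (scale M n) x a := by
      intro b hb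
      obtain ⟨j, hj, hb⟩ := mem_iUnion₂.1 hb
      obtain ⟨c, hc, hc'⟩ := (Finset.mem_filter.1 hj).2
      have h1 := abs_graph_sub_le_of_floor_eq hM (x := x) ⟨by linarith [hx.1], by linarith [hx.2]⟩
        (hb.2.trans hc'.2.symm)
      have := abs_sub_le (graph M x b) (graph M x c) (graph M x a)
      exact ⟨hb.1, by linarith [hc.2]⟩
    have h1 := (measure_mono hsub).trans h
    rw [measure_biUnion_finset (fun i _ j _ hij => disjoint_left.2 fun b hb hb' =>
      hij (hb.2.symm.trans hb'.2)) fun j hj => measurableSet_prefixSet (hPlt j hj),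
      Finset.sum_congr rfl fun j hj => volume_prefixSet (hPlt j hj), Finset.sum_const,
      nsmul_eq_mul, ← ENNReal.ofReal_natCast, ← ENNReal.ofReal_mul (by positivity), ← scale_eq,
      ENNReal.ofReal_le_ofReal_iff (mul_nonneg hK (scale_pos M n).le)] at h1
    exact le_of_mul_le_mul_right h1 (scale_pos M n)
  calc volume A ≤ ∑ j ∈ P, volume (A ∩ prefixSet S j) :=
        (measure_mono hcover).trans (measure_biUnion_finset_le _ _)
    _ ≤ ∑ _j ∈ P, ENNReal.ofReal (25 * r) := Finset.sum_le_sum hpiece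
    _ = ENNReal.ofReal (P.card * (25 * r)) := by
        rw [Finset.sum_const, nsmul_eq_mul, ← ENNReal.ofReal_natCast,
          ← ENNReal.ofReal_mul (by positivity)]
    _ ≤ _ := by
        refine ENNReal.ofReal_le_ofReal ?_
        nlinarith

/-- A bound at a small scale implies one at all larger scales. -/
lemma volume_near_le_of_fine {M : ℕ → ℕ} {δ x y r K : ℝ} {G : Set ℝ} (hG : G ⊆ Ico (0 : ℝ) 1)
    (hδ : 0 < δ) (hr : δ ≤ r) (hK : 0 ≤ K)
    (h : ∀ a ∈ G, volume (nearSet M δ x a) ≤ ENNReal.ofReal (K * δ)) :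
    volume {a ∈ G | |graph M x a - y| ≤ r} ≤ ENNReal.ofReal (3 * K * r) := by
  set A := {a ∈ G | |graph M x a - y| ≤ r}
  -- The heights in `[y - r, y + r]` are sorted into cells of length `δ`; a nonempty cell is
  -- contained in the near set of any of its members, and there are at most `3 * r / δ` cells.
  let f : ℝ → ℕ := fun a => ⌊(graph M x a - (y - r)) / δ⌋₊
  let N := ⌊2 * r / δ⌋₊ + 1
  have hpos : ∀ a ∈ A, 0 ≤ (graph M x a - (y - r)) / δ := fun a ha =>
    div_nonneg (by linarith [(abs_le.1 ha.2).1]) hδ.le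
  have hcover : A ⊆ ⋃ i ∈ Finset.range N, {a ∈ A | f a = i} := by
    intro a ha
    refine mem_iUnion₂.2 ⟨f a, Finset.mem_range.2 (Nat.lt_succ_of_le (Nat.floor_mono ?_)), ha, rfl⟩
    gcongr
    linarith [(abs_le.1 ha.2).2]
  have hpiece : ∀ i ∈ Finset.range N, volume {a ∈ A | f a = i} ≤ ENNReal.ofReal (K * δ) := by
    intro i _
    rcases {a ∈ A | f a = i}.eq_empty_or_nonempty with he | ⟨a, ha, hfa⟩
    · simp [he]
    · refine (measure_mono fun b hb => ?_).trans (h a ha.1)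
      refine ⟨hG hb.1.1, ?_⟩
      have h1 := (Nat.floor_eq_iff (hpos a ha)).1 hfa
      have h2 := (Nat.floor_eq_iff (hpos b hb.1)).1 hb.2
      rw [le_div_iff₀ hδ, div_lt_iff₀ hδ] at h1 h2
      rw [abs_le]
      constructor <;> linarith [h1.1, h1.2, h2.1, h2.2]
  calc volume A ≤ ∑ i ∈ Finset.range N, volume {a ∈ A | f a = i} :=
        (measure_mono hcover).trans (measure_biUnion_finset_le _ _)
    _ ≤ ∑ _i ∈ Finset.range N, ENNReal.ofReal (K * δ) := Finset.sum_le_sum hpiece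
    _ = ENNReal.ofReal (N * (K * δ)) := by
        rw [Finset.sum_const, nsmul_eq_mul, Finset.card_range, ← ENNReal.ofReal_natCast,
          ← ENNReal.ofReal_mul (by positivity)]
    _ ≤ _ := by
        refine ENNReal.ofReal_le_ofReal ?_
        have h1 : (N : ℝ) * δ ≤ 3 * r := by
          have := Nat.floor_le (show 0 ≤ 2 * r / δ from div_nonneg (by linarith) hδ.le)
          rw [le_div_iff₀ hδ] at this
          simp only [N]
          push_cast
          linarith
        nlinarith

/-! ### Córdoba's overlap estimate -/

/-- The parameters of the points of the limit lines over the strip. -/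
def parameterSet : Set (ℝ × ℝ) := Icc (1 / 2 : ℝ) (3 / 4) ×ˢ Ico (0 : ℝ) 1

lemma measurableSet_parameterSet : MeasurableSet parameterSet :=
  measurableSet_Icc.prod measurableSet_Ico

lemma measurableSet_nearSet {M : ℕ → ℕ} (hM : IsParameter M) (δ : ℝ) :
    MeasurableSet {z : (ℝ × ℝ) × ℝ | z.2 ∈ nearSet M δ z.1.1 z.1.2} := by
  have hg := measurable_graph hM
  refine (measurable_snd measurableSet_Ico).inter ?_
  exact measurableSet_le
    (((hg.comp (by fun_prop : Measurable fun z : (ℝ × ℝ) × ℝ => (z.1.1, z.2))).sub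
      (hg.comp measurable_fst)).abs) measurable_const

lemma measurable_volume_nearSet {M : ℕ → ℕ} (hM : IsParameter M) (δ : ℝ) :
    Measurable fun q : ℝ × ℝ => volume (nearSet M δ q.1 q.2) :=
  measurable_measure_prodMk_left (measurableSet_nearSet hM δ)

/-- Two lines are close to each other over a short interval only. -/
lemma volume_close_le (M : ℕ → ℕ) {δ a a' : ℝ} (ha : a ∈ Ico (0 : ℝ) 1)
    (ha' : a' ∈ Ico (0 : ℝ) 1) (h : a' ≠ a) :
    volume {x | |graph M x a' - graph M x a| ≤ δ} ≤ ENNReal.ofReal (2 * δ / |a' - a|) := by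
  refine volume_le_of_abs_sub_le fun x hx y hy => ?_
  rw [le_div_iff₀ (abs_pos.2 (sub_ne_zero.2 h)), ← abs_mul]
  simp only [mem_ofPred_eq, graph_sub_graph M _ ha' ha] at hx hy
  rw [abs_le] at *
  constructor <;> nlinarith

/-- Dyadic decomposition of `|a' - a|`: the least `j` with `|a' - a| ≤ 2 ^ j * δ` alone bounds the
left side. For `j > 0` the constant is `2 * 3 * 2 = 12`, as `|a' - a| > 2 ^ (j - 1) * δ`; for `j =
0` the whole strip is allowed. -/
lemma volume_close_le_sum (M : ℕ → ℕ) {S : ℕ} {a a' : ℝ} (ha : a ∈ Ico (0 : ℝ) 1)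
    (ha' : a' ∈ Ico (0 : ℝ) 1) :
    volume {x ∈ Icc (1 / 2 : ℝ) (3 / 4) |
        |graph M x a' - graph M x a| ≤ 3 * ((2 : ℝ) ^ S)⁻¹} ≤
      ∑ j ∈ Finset.range (S + 1), (Icc (a - 2 ^ j * ((2 : ℝ) ^ S)⁻¹)
        (a + 2 ^ j * ((2 : ℝ) ^ S)⁻¹)).indicator (fun _ => ENNReal.ofReal (12 / 2 ^ j)) a' := by
  classical
  set δ := ((2 : ℝ) ^ S)⁻¹ with hδ
  have hδ0 : 0 < δ := by positivity
  have hex : ∃ j : ℕ, |a' - a| ≤ 2 ^ j * δ := by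
    refine ⟨S, ?_⟩
    rw [hδ, mul_inv_cancel₀ (by positivity), abs_le]
    constructor <;> linarith [ha.1, ha.2, ha'.1, ha'.2]
  have hjS : Nat.find hex ≤ S := Nat.find_min' hex (by
    rw [hδ, mul_inv_cancel₀ (by positivity), abs_le]
    constructor <;> linarith [ha.1, ha.2, ha'.1, ha'.2])
  have hj := Nat.find_spec hex
  set j := Nat.find hex with hjdef
  have hterm : (Icc (a - 2 ^ j * δ) (a + 2 ^ j * δ)).indicator
      (fun _ => ENNReal.ofReal (12 / 2 ^ j)) a' = ENNReal.ofReal (12 / 2 ^ j) := by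
    refine indicator_of_mem ?_ _
    rw [abs_le] at hj
    constructor <;> linarith [hj.1, hj.2]
  refine le_trans ?_ (Finset.single_le_sum (f := fun j => (Icc (a - 2 ^ j * δ)
    (a + 2 ^ j * δ)).indicator (fun _ => ENNReal.ofReal (12 / 2 ^ j)) a')
    (fun _ _ => zero_le) (Finset.mem_range.2 (Nat.lt_succ_of_le hjS)))
  rw [hterm]
  rcases Nat.eq_zero_or_pos j with h0 | h0
  · refine (measure_mono (t := Icc (1 / 2 : ℝ) (3 / 4)) fun x hx => hx.1).trans ?_
    rw [Real.volume_Icc, h0]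
    exact ENNReal.ofReal_le_ofReal (by norm_num)
  · obtain ⟨i, hi⟩ := Nat.exists_eq_add_of_le' h0
    have hlt : 2 ^ i * δ < |a' - a| := by
      have := Nat.find_min hex (m := i) (by omega)
      exact not_le.1 this
    have hne : a' ≠ a := by
      rintro rfl
      rw [sub_self, abs_zero] at hlt
      exact absurd hlt (not_lt.2 (by positivity))
    refine (measure_mono fun x hx => hx.2).trans ((volume_close_le M ha ha' hne).trans ?_)
    refine ENNReal.ofReal_le_ofReal ?_
    rw [hi, pow_succ, div_le_div_iff₀ (lt_trans (by positivity) hlt) (by positivity)]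
    nlinarith

/-- Córdoba's bound for the overlap of the neighbourhoods of the limit lines. -/
lemma lintegral_volume_nearSet_le {M : ℕ → ℕ} (hM : IsParameter M) (S : ℕ) :
    ∫⁻ q in parameterSet, volume (nearSet M ((2 : ℝ) ^ S)⁻¹ q.1 q.2) ≤
      ENNReal.ofReal (24 * (S + 1) * ((2 : ℝ) ^ S)⁻¹) := by
  set δ := ((2 : ℝ) ^ S)⁻¹ with hδ
  have hδ0 : 0 < δ := by positivity
  have hmeas := measurable_volume_nearSet hM δ
  have hinner : ∀ a ∈ Ico (0 : ℝ) 1,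
      ∫⁻ x in Icc (1 / 2 : ℝ) (3 / 4), volume (nearSet M δ x a) ≤
        ENNReal.ofReal (24 * (S + 1) * δ) := by
    intro a ha
    have hW : MeasurableSet {z : ℝ × ℝ | z.2 ∈ nearSet M δ z.1 a} :=
      (by fun_prop : Measurable fun z : ℝ × ℝ => ((z.1, a), z.2)) (measurableSet_nearSet hM δ)
    have e1 := Measure.prod_apply (μ := volume.restrict (Icc (1 / 2 : ℝ) (3 / 4)))
      (ν := (volume : Measure ℝ)) hW
    have e2 := Measure.prod_apply_symm (μ := volume.restrict (Icc (1 / 2 : ℝ) (3 / 4)))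
      (ν := (volume : Measure ℝ)) hW
    calc ∫⁻ x in Icc (1 / 2 : ℝ) (3 / 4), volume (nearSet M δ x a)
        = ∫⁻ a', volume.restrict (Icc (1 / 2 : ℝ) (3 / 4)) {x | a' ∈ nearSet M δ x a} :=
          e1.symm.trans e2
      _ ≤ ∫⁻ a', ∑ j ∈ Finset.range (S + 1), (Icc (a - 2 ^ j * δ) (a + 2 ^ j * δ)).indicator
            (fun _ => ENNReal.ofReal (12 / 2 ^ j)) a' := by
          refine lintegral_mono fun a' => ?_
          rw [Measure.restrict_apply' measurableSet_Icc]
          by_cases ha' : a' ∈ Ico (0 : ℝ) 1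
          · refine (measure_mono fun x hx => ?_).trans (volume_close_le_sum M ha ha')
            exact ⟨hx.2, hx.1.2⟩
          · have : {x | a' ∈ nearSet M δ x a} ∩ Icc (1 / 2 : ℝ) (3 / 4) = ∅ :=
              eq_empty_of_forall_notMem fun x hx => ha' hx.1.1
            rw [this, measure_empty]
            exact zero_le
      -- Each dyadic shell contributes the same amount, `(2 * 2 ^ j * δ) * (12 / 2 ^ j)`; the number
      -- `S + 1` of shells is the logarithm.
      _ = ∑ j ∈ Finset.range (S + 1), ENNReal.ofReal (24 * δ) := by
          rw [lintegral_finsetSum _ fun j _ => measurable_const.indicator measurableSet_Icc]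
          refine Finset.sum_congr rfl fun j _ => ?_
          rw [lintegral_indicator_const measurableSet_Icc, Real.volume_Icc,
            ← ENNReal.ofReal_mul (by positivity)]
          congr 1
          field_simp
          ring
      _ = _ := by
          rw [Finset.sum_const, nsmul_eq_mul, Finset.card_range, ← ENNReal.ofReal_natCast,
            ← ENNReal.ofReal_mul (by positivity)]
          congr 1
          push_cast
          ring
  rw [parameterSet, Measure.volume_eq_prod, ← Measure.prod_restrict,
    lintegral_prod_symm _ hmeas.aemeasurable]
  calc _ ≤ ∫⁻ _a in Ico (0 : ℝ) 1, ENNReal.ofReal (24 * (S + 1) * δ) :=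
        setLIntegral_mono measurable_const hinner
    _ = _ := by simp

/-! ### Points with few nearby lines at all small scales -/

/-- The parameters of the points with few lines nearby, at all scales from the `n₀`-th on. -/
def goodSet (M : ℕ → ℕ) (K : ℕ → ℝ) (n₀ : ℕ) : Set (ℝ × ℝ) :=
  {q ∈ parameterSet | ∀ n ≥ n₀, volume (nearSet M (scale M n) q.1 q.2) ≤
    ENNReal.ofReal (K n * (offset M n + 1) * scale M n)}

lemma measurableSet_goodSet {M : ℕ → ℕ} (hM : IsParameter M) (K : ℕ → ℝ) (n₀ : ℕ) :
    MeasurableSet (goodSet M K n₀) := by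
  refine measurableSet_parameterSet.inter ?_
  have : {q : ℝ × ℝ | ∀ n ≥ n₀, volume (nearSet M (scale M n) q.1 q.2) ≤
      ENNReal.ofReal (K n * (offset M n + 1) * scale M n)} =
      ⋂ n, ⋂ (_ : n ≥ n₀), {q : ℝ × ℝ | volume (nearSet M (scale M n) q.1 q.2) ≤
        ENNReal.ofReal (K n * (offset M n + 1) * scale M n)} := by
    ext q
    simp
  rw [show (fun q : ℝ × ℝ => ∀ n ≥ n₀, volume (nearSet M (scale M n) q.1 q.2) ≤
      ENNReal.ofReal (K n * (offset M n + 1) * scale M n)) = _ from this]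
  exact MeasurableSet.iInter fun n => MeasurableSet.iInter fun _ =>
    measurableSet_le (measurable_volume_nearSet hM _) measurable_const

/-- By Chebyshev the bad set at scale `n` has measure at most `24 / K n`. Borel–Cantelli puts almost
every parameter into some `goodSet`, and a countable union of null sets cannot exhaust
`parameterSet`. -/
lemma exists_volume_goodSet_pos {M : ℕ → ℕ} (hM : IsParameter M) {K : ℕ → ℝ} (hK : ∀ n, 0 < K n)
    (hsum : Summable fun n => (K n)⁻¹) (n₁ : ℕ) :
    ∃ n₀ ≥ n₁, 0 < volume (goodSet M K n₀) := by
  set μ := (volume : Measure (ℝ × ℝ)).restrict parameterSet with hμ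
  let bad : ℕ → Set (ℝ × ℝ) := fun n => {q | ENNReal.ofReal (K n * (offset M n + 1) * scale M n) ≤
    volume (nearSet M (scale M n) q.1 q.2)}
  have hbad : ∀ n, μ (bad n) ≤ ENNReal.ofReal (24 * (K n)⁻¹) := by
    intro n
    have hpos : 0 < K n * (offset M n + 1) * scale M n := by
      have := hK n
      have := scale_pos M n
      positivity
    refine (meas_ge_le_lintegral_div (measurable_volume_nearSet hM _).aemeasurable
      (ENNReal.ofReal_pos.2 hpos).ne' ENNReal.ofReal_ne_top).trans ?_
    have := lintegral_volume_nearSet_le hM (offset M n)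
    rw [← scale_eq] at this
    refine (ENNReal.div_le_div_right this _).trans ?_
    rw [← ENNReal.ofReal_div_of_pos hpos]
    refine ENNReal.ofReal_le_ofReal (le_of_eq ?_)
    have := (hK n).ne'
    have := (scale_pos M n).ne'
    field_simp
  have htsum : ∑' n, μ (bad n) ≠ ⊤ := by
    refine ne_top_of_le_ne_top ?_ (ENNReal.tsum_le_tsum hbad)
    exact (hsum.mul_left 24).tsum_ofReal_ne_top
  have hae := ae_eventually_notMem htsum
  by_contra! hcon
  have hnull : volume (⋃ n, goodSet M K (n + n₁)) = 0 :=
    measure_iUnion_null fun n => le_antisymm (hcon _ (Nat.le_add_left _ _)) zero_le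
  have hsub : parameterSet ⊆ (⋃ n, goodSet M K (n + n₁)) ∪
      ({q | ¬ ∀ᶠ n in atTop, q ∉ bad n} ∩ parameterSet) := by
    intro q hq
    by_cases h : ∀ᶠ n in atTop, q ∉ bad n
    · obtain ⟨n, hn⟩ := eventually_atTop.1 h
      refine Or.inl (mem_iUnion.2 ⟨n, hq, fun m hm => ?_⟩)
      exact (not_le.1 (hn m (by omega))).le
    · exact Or.inr ⟨h, hq⟩
  rw [ae_iff, hμ, Measure.restrict_apply' measurableSet_parameterSet] at hae
  have h0 : volume parameterSet = 0 := measure_mono_null hsub (measure_union_null hnull hae)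
  rw [parameterSet, Measure.volume_eq_prod, Measure.prod_prod, Real.volume_Icc, Real.volume_Ico,
    ← ENNReal.ofReal_mul (by norm_num), ENNReal.ofReal_eq_zero] at h0
  norm_num at h0

lemma exists_scale_between {M : ℕ → ℕ} (hM : IsParameter M) {n₀ : ℕ} {r : ℝ} (hr : 0 < r)
    (h : r ≤ scale M n₀) : ∃ n ≥ n₀, scale M (n + 1) ≤ r ∧ r ≤ scale M n := by
  classical
  have hex : ∃ n, scale M n < r := (hM.scale_tendsto.eventually_lt_const hr).exists
  have h1 := Nat.find_spec hex
  have hlt : n₀ < Nat.find hex := by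
    by_contra! hle
    exact absurd (h.trans (scale_antitone M hle)) (not_le.2 h1)
  obtain ⟨n, hn⟩ := Nat.exists_eq_add_of_lt hlt
  refine ⟨n₀ + n, by omega, ?_, not_lt.1 (Nat.find_min hex (by omega))⟩
  rw [hn] at h1
  exact h1.le

lemma le_tlog_one_div {r : ℝ} {N : ℕ} (hr : 0 < r) (h : r ≤ ((2 : ℝ) ^ N)⁻¹) :
    (N : ℝ) ≤ tlog (1 / r) := by
  have : Real.logb 2 (2 ^ N) ≤ Real.logb 2 (1 / r) := by
    refine Real.logb_le_logb_of_le one_lt_two (by positivity) ?_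
    rw [le_div_iff₀ hr, mul_comm]
    rwa [← one_div, le_div_iff₀ (by positivity)] at h
  rw [Real.logb_pow, Real.logb_self_eq_one one_lt_two, mul_one] at this
  exact this.trans (le_max_left _ _)

/-- The scales between `δ_{n+1}` and `δ_n` split at `2 ^ (-(S_n + M_n / 4))`. Above it the bound at
`δ_n` is used, with `K n ≤ φ (scale M n) ≤ φ r`; below it the one at `δ_{n+1}`, with `K (n + 1)`
compared to `φ` at `2 ^ (-(M_n / 4))`. -/
lemma volume_section_goodSet_le {M : ℕ → ℕ} (hM : IsParameter M) {K : ℕ → ℝ} (hK : ∀ n, 0 < K n)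
    {φ : ℝ → ℝ} (hφ : AntitoneOn φ (Ioc 0 1)) {n₀ : ℕ} (hn₀ : 1 ≤ n₀)
    (hM4 : ∀ n ≥ n₀, 4 ≤ M n)
    (hKφ : ∀ n ≥ n₀, K n ≤ φ (scale M n) ∧ K (n + 1) ≤ φ ((2 : ℝ) ^ (M n / 4))⁻¹)
    {x y r : ℝ} (hr : 0 < r) (hr' : r ≤ scale M n₀) :
    volume {a | (x, a) ∈ goodSet M K n₀ ∧ |graph M x a - y| ≤ r} ≤
      ENNReal.ofReal (50 * (r * tlog (1 / r) * φ r)) := by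
  obtain ⟨n, hn, hr1, hr2⟩ := exists_scale_between hM hr hr'
  have hscale : scale M n ≤ 1 := (scale_antitone M (Nat.zero_le n)).trans_eq (scale_zero M)
  have hone : r ≤ 1 := hr2.trans hscale
  have hK0 := (hK n)
  have hK1 := (hK (n + 1))
  obtain ⟨hφ1, hφ2⟩ := hKφ n hn
  have hS : (1 : ℝ) ≤ offset M n := by exact_mod_cast (hn₀.trans hn).trans (hM.le_offset n)
  rcases le_total ((2 : ℝ) ^ (offset M n + M n / 4))⁻¹ r with hc | hc
  · rcases {a | (x, a) ∈ goodSet M K n₀ ∧ |graph M x a - y| ≤ r}.eq_empty_or_nonempty with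
      he | ⟨a, ha, hay⟩
    · rw [he, measure_empty]
      exact zero_le
    refine (measure_mono fun b hb => ?_).trans ((volume_near_le_of_coarse hM (a := a) ha.1.1
      (K := K n * (offset M n + 1)) (by positivity) hc hr2 (ha.2 n hn)).trans ?_)
    · refine ⟨hb.1.1.2, ?_⟩
      have := abs_sub_le (graph M x b) y (graph M x a)
      rw [abs_sub_comm y] at this
      linarith [hb.2]
    · refine ENNReal.ofReal_le_ofReal ?_
      have h1 : K n ≤ φ r :=
        hφ1.trans (hφ ⟨hr, hone⟩ ⟨scale_pos M n, hscale⟩ hr2)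
      have h2 : (offset M n : ℝ) ≤ tlog (1 / r) := le_tlog_one_div hr (by rwa [← scale_eq])
      have h3 : K n * (offset M n + 1) ≤ φ r * (2 * tlog (1 / r)) :=
        mul_le_mul h1 (by linarith) (by positivity) (hK0.le.trans h1)
      nlinarith
  · have key := volume_near_le_of_fine (M := M) (x := x) (y := y) (K := K (n + 1) * (offset M (n + 1) + 1))
      (G := {a | (x, a) ∈ goodSet M K n₀}) (fun a ha => ha.1.2) (scale_pos M (n + 1)) hr1
      (by positivity) (fun a ha => ha.2 (n + 1) (by omega))
    refine key.trans (ENNReal.ofReal_le_ofReal ?_)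
    have h1 : K (n + 1) ≤ φ r := by
      refine hφ2.trans (hφ ⟨hr, hone⟩ ⟨by positivity, inv_le_one_of_one_le₀
        (one_le_pow₀ one_le_two)⟩ (hc.trans (inv_anti₀ (by positivity)
        (pow_le_pow_right₀ one_le_two (Nat.le_add_left _ _)))))
    have h2 := le_tlog_one_div hr hc
    -- `log (1/r) ≥ S_n + M_n / 4` is comparable to `S_{n+1} = S_n + M_n`; the `8` absorbs the
    -- rounding in `M n / 4`, which is at least `1`.
    have h3 : (offset M (n + 1) : ℝ) + 1 ≤ 8 * tlog (1 / r) := by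
      have h4 := hM4 n hn
      have h6 : 1 ≤ offset M n := by exact_mod_cast hS
      have h7 : offset M (n + 1) + 1 ≤ 8 * (offset M n + M n / 4) := by
        rw [offset_succ]; omega
      have h8 : (offset M (n + 1) : ℝ) + 1 ≤ 8 * ((offset M n + M n / 4 : ℕ) : ℝ) := by
        exact_mod_cast h7
      linarith
    have h9 : K (n + 1) * (offset M (n + 1) + 1) ≤ φ r * (8 * tlog (1 / r)) :=
      mul_le_mul h1 h3 (by positivity) (hK1.le.trans h1)
    have h10 : 0 ≤ φ r * tlog (1 / r) :=
      mul_nonneg (hK1.le.trans h1) (zero_le_one.trans (one_le_tlog _))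
    nlinarith

/-! ### Mass distribution and positive measure -/

/-- The point of a limit line over `x`. -/
def graphPoint (M : ℕ → ℕ) (q : ℝ × ℝ) : Plane := !₂[q.1, graph M q.1 q.2]

lemma measurable_graphPoint {M : ℕ → ℕ} (hM : IsParameter M) : Measurable (graphPoint M) := by
  refine (WithLp.measurable_toLp 2 (Fin 2 → ℝ)).comp (measurable_pi_lambda _ fun i => ?_)
  fin_cases i
  · exact measurable_fst
  · exact measurable_graph hM

lemma goodSet_subset_preimage {M : ℕ → ℕ} (hM : IsParameter M) (K : ℕ → ℝ) (n₀ : ℕ) :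
    goodSet M K n₀ ⊆ graphPoint M ⁻¹' limitSet M :=
  fun _ hq => hM.mem_limitSet _ hq.1.1

lemma volume_rectangle_le {M : ℕ → ℕ} (hM : IsParameter M) {K : ℕ → ℝ} {n₀ : ℕ} {r C x₀ y₀ : ℝ}
    (hr : 0 ≤ r)
    (h : ∀ x, volume {a | (x, a) ∈ goodSet M K n₀ ∧ |graph M x a - y₀| ≤ r} ≤
      ENNReal.ofReal C) :
    volume {q ∈ goodSet M K n₀ | |q.1 - x₀| ≤ r ∧ |graph M q.1 q.2 - y₀| ≤ r} ≤
      ENNReal.ofReal (2 * r * C) := by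
  set A := {q ∈ goodSet M K n₀ | |q.1 - x₀| ≤ r ∧ |graph M q.1 q.2 - y₀| ≤ r}
  have hA : MeasurableSet A := by
    refine (measurableSet_goodSet hM K n₀).inter (MeasurableSet.inter ?_ ?_)
    · exact measurableSet_le ((measurable_fst.sub_const _).abs) measurable_const
    · exact measurableSet_le (((measurable_graph hM).sub_const _).abs) measurable_const
  rw [Measure.volume_eq_prod, Measure.prod_apply hA]
  calc _ ≤ ∫⁻ x, (Icc (x₀ - r) (x₀ + r)).indicator (fun _ => ENNReal.ofReal C) x := by
        refine lintegral_mono fun x => ?_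
        by_cases hx : x ∈ Icc (x₀ - r) (x₀ + r)
        · rw [indicator_of_mem hx]
          refine (measure_mono fun a ha => ?_).trans (h x)
          exact ⟨ha.1, ha.2.2⟩
        · have : Prod.mk x ⁻¹' A = ∅ := eq_empty_of_forall_notMem fun a ha => hx (by
            have := abs_le.1 ha.2.1
            constructor <;> linarith [this.1, this.2])
          rw [this, measure_empty]
          exact zero_le
    _ = _ := by
        rw [lintegral_indicator_const measurableSet_Icc, Real.volume_Icc, mul_comm,
          ← ENNReal.ofReal_mul (by linarith)]
        congr 1
        ring

theorem gaugeMeasure_limitSet_pos {M : ℕ → ℕ} (hM : IsParameter M) {K : ℕ → ℝ} (hK : ∀ n, 0 < K n)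
    (hsum : Summable fun n => (K n)⁻¹) {φ : ℝ → ℝ} (hφ : AntitoneOn φ (Ioc 0 1))
    (hKφ : ∀ᶠ n in atTop, K n ≤ φ (scale M n) ∧ K (n + 1) ≤ φ ((2 : ℝ) ^ (M n / 4))⁻¹) :
    0 < gaugeMeasure (fun r => gauge r * φ r) (limitSet M) := by
  obtain ⟨n₁, hn₁⟩ := eventually_atTop.1
    (hKφ.and ((hM.tendsto.eventually_ge_atTop 4).and (eventually_ge_atTop 1)))
  obtain ⟨n₀, hn₀, hpos⟩ := exists_volume_goodSet_pos hM hK hsum n₁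
  set μ := ((volume : Measure (ℝ × ℝ)).restrict (goodSet M K n₀)).map (graphPoint M) with hμ
  have hT := measurable_graphPoint hM
  have hc0 : ENNReal.ofReal 100 ≠ 0 := (ENNReal.ofReal_pos.2 (by norm_num)).ne'
  have hle : (ENNReal.ofReal 100)⁻¹ • μ ≤ gaugeMeasure fun r => gauge r * φ r := by
    refine Measure.le_mkMetric _ _ (ENNReal.ofReal (scale M n₀))
      (ENNReal.ofReal_pos.2 (scale_pos M n₀)) fun s hs => ?_
    rw [Measure.smul_apply, smul_eq_mul]
    have hne : Metric.ediam s ≠ ⊤ := ne_top_of_le_ne_top ENNReal.ofReal_ne_top hs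
    have hr' : (Metric.ediam s).toReal ≤ scale M n₀ :=
      ENNReal.toReal_le_of_le_ofReal (scale_pos M n₀).le hs
    have hdist : ∀ p ∈ s, ∀ q ∈ s, dist p q ≤ (Metric.ediam s).toReal := fun p hp q hq => by
      rw [dist_edist]
      exact ENNReal.toReal_mono hne (Metric.edist_le_ediam_of_mem hp hq)
    set r := (Metric.ediam s).toReal with hrdef
    have hr0 : 0 ≤ r := ENNReal.toReal_nonneg
    rcases s.eq_empty_or_nonempty with rfl | ⟨p, hp⟩
    · simp
    -- The set `s` need not be measurable, so the push-forward is evaluated on a closed square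
    -- around one of its points.
    let R : Set Plane := {q | |q 0 - p 0| ≤ r ∧ |q 1 - p 1| ≤ r}
    have hsR : s ⊆ R := fun q hq =>
      ⟨(plane_abs_sub_le q p 0).trans (hdist q hq p hp),
        (plane_abs_sub_le q p 1).trans (hdist q hq p hp)⟩
    have hRc : MeasurableSet R := by
      have h0 : Continuous fun p : Plane => p 0 := by fun_prop
      have h1 : Continuous fun p : Plane => p 1 := by fun_prop
      exact ((isClosed_le ((h0.sub continuous_const).abs) continuous_const).inter
        (isClosed_le ((h1.sub continuous_const).abs) continuous_const)).measurableSet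
    have hμR : μ R ≤ ENNReal.ofReal (100 * (gauge r * φ r)) := by
      rw [hμ, Measure.map_apply hT hRc, Measure.restrict_apply (hT hRc), inter_comm]
      change volume {q ∈ goodSet M K n₀ | |q.1 - p 0| ≤ r ∧ |graph M q.1 q.2 - p 1| ≤ r} ≤ _
      -- At diameter `0` the gauge vanishes, so points must have zero mass; the trivial bound `1` on
      -- the sections gives this.
      rcases hr0.eq_or_lt with h0 | h0
      · refine (volume_rectangle_le hM (C := 1) hr0 fun x => ?_).trans ?_
        · refine (measure_mono (t := Ico (0 : ℝ) 1) fun a ha => ha.1.1.2).trans ?_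
          simp
        · simp [← h0, gauge]
      · refine (volume_rectangle_le hM hr0 fun x => volume_section_goodSet_le hM hK hφ
          (hn₁ n₀ hn₀).2.2 (fun n hn => (hn₁ n (hn₀.trans hn)).2.1)
          (fun n hn => (hn₁ n (hn₀.trans hn)).1) h0 hr').trans ?_
        refine ENNReal.ofReal_le_ofReal (le_of_eq ?_)
        simp only [gauge]
        ring
    calc _ ≤ (ENNReal.ofReal 100)⁻¹ * ENNReal.ofReal (100 * (gauge r * φ r)) := by
          gcongr
          exact (measure_mono hsR).trans hμR
      _ = ENNReal.ofReal (gauge r * φ r) := by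
          rw [ENNReal.ofReal_mul (by norm_num), ← mul_assoc,
            ENNReal.inv_mul_cancel hc0 ENNReal.ofReal_ne_top, one_mul]
  refine lt_of_lt_of_le ?_ (hle (limitSet M))
  rw [Measure.smul_apply, smul_eq_mul]
  refine ENNReal.mul_pos (ENNReal.inv_ne_zero.2 ENNReal.ofReal_ne_top) (ne_of_gt ?_)
  have hE := (limitSet_isCompact M).isClosed.measurableSet
  rw [hμ, Measure.map_apply hT hE, Measure.restrict_apply (hT hE),
    inter_eq_right.2 (goodSet_subset_preimage hM K n₀)]
  exact hpos

theorem exists_growth_gaugeMeasure_pos {φ : ℝ → ℝ} (hφ : IsGaugeFactor φ) :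
    ∃ g : ℕ → ℕ, ∀ M : ℕ → ℕ, IsParameter M → (∀ᶠ n in atTop, g (M n) ≤ M (n + 1)) →
      0 < gaugeMeasure (fun r => gauge r * φ r) (limitSet M) := by
  have hlim : Tendsto (fun m : ℕ => φ ((2 : ℝ) ^ (m / 4))⁻¹) atTop atTop := by
    refine hφ.tendsto.comp (tendsto_inv_atTop_nhdsGT_zero.comp ?_)
    exact (tendsto_pow_atTop_atTop_of_one_lt one_lt_two).comp
      (Nat.tendsto_div_const_atTop (by norm_num))
  have hN : ∀ m : ℕ, ∃ N, ∀ k ≥ N, (m : ℝ) ≤ φ ((2 : ℝ) ^ (k / 4))⁻¹ := fun m =>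
    eventually_atTop.1 (hlim.eventually_ge_atTop (m : ℝ))
  choose N hN using hN
  -- `N m` makes `φ` exceed `m` from the first quarter of the next block on; `m + 1` forces a strict
  -- increase, hence doubling.
  refine ⟨fun m => max (N m) (m + 1), fun M hM hg => ?_⟩
  have hpos : ∀ n, (0 : ℝ) < M n := fun n => by
    exact_mod_cast lt_of_lt_of_le two_pos (hM.two_le n)
  -- The shift by two fits both conditions: `K (n + 1) = M (n - 1)` is controlled by the choice of
  -- `M n`, and `K n = M (n - 2)` by that of `M (n - 1)`, as `scale M n ≤ 2 ^ (-M (n - 1))`.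
  -- Doubling makes `∑ 1 / K n` converge.
  refine gaugeMeasure_limitSet_pos hM (K := fun n => (M (n - 2) : ℝ)) (fun n => hpos _) ?_ hφ.anti
    ?_
  · rw [← summable_nat_add_iff 2]
    refine summable_of_ratio_norm_eventually_le (r := 1 / 2) (by norm_num) ?_
    filter_upwards [hg] with n hn
    have h1 : 2 * M n ≤ M (n + 1) := hM.two_mul_le (by omega)
    have h2 : (2 : ℝ) * M n ≤ M (n + 1) := by exact_mod_cast h1
    have h3 := hpos n
    simp only [Nat.add_sub_cancel, norm_inv, Real.norm_natCast]
    rw [one_div, ← mul_inv]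
    exact inv_anti₀ (by positivity) h2
  · obtain ⟨n₁, hn₁⟩ := eventually_atTop.1 hg
    filter_upwards [eventually_ge_atTop (n₁ + 2)] with n hn
    obtain ⟨k, rfl⟩ := Nat.exists_eq_add_of_le' (show 2 ≤ n by omega)
    have key : ∀ j ≥ n₁, (M j : ℝ) ≤ φ ((2 : ℝ) ^ (M (j + 1) / 4))⁻¹ := fun j hj =>
      hN _ _ ((le_max_left _ _).trans (hn₁ j hj))
    refine ⟨(key k (by omega)).trans (hφ.anti ⟨scale_pos M _, ?_⟩
      ⟨by positivity, inv_le_one_of_one_le₀ (one_le_pow₀ one_le_two)⟩ ?_), key (k + 1) (by omega)⟩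
    · exact (scale_antitone M (Nat.zero_le _)).trans_eq (scale_zero M)
    · rw [scale_eq, offset_succ]
      exact inv_anti₀ (by positivity) (pow_le_pow_right₀ one_le_two (by omega))

/-! ### Iterated logarithms and comparison of gauges -/

lemma tlog_pos (r : ℝ) : 0 < tlog r := zero_lt_one.trans_le (one_le_tlog r)

lemma tendsto_tlog : Tendsto tlog atTop atTop :=
  tendsto_atTop_mono (fun _ => le_max_left _ _) (Real.tendsto_logb_atTop one_lt_two)

lemma tendsto_one_div_nhdsGT_zero : Tendsto (fun r : ℝ => 1 / r) (𝓝[>] 0) atTop := by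
  simpa only [one_div] using tendsto_inv_nhdsGT_zero (𝕜 := ℝ)

lemma tlog_le_self {t : ℝ} (ht : 1 ≤ t) : tlog t ≤ t := max_le (logb_two_le_self ht) ht

lemma tlog_lt_self {t : ℝ} (ht : 2 ≤ t) : tlog t < t := by
  refine max_lt ?_ (by linarith)
  rw [Real.logb_lt_iff_lt_rpow one_lt_two (by linarith)]
  have h := one_add_mul_self_le_rpow_one_add (s := 1) (p := t) (by norm_num) (by linarith)
  norm_num at h
  linarith

lemma tlog_two_mul_le {s : ℝ} (hs : 0 < s) : tlog (2 * s) ≤ tlog s + 1 := by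
  have := tlog_mul_le one_le_two hs
  rw [Real.logb_self_eq_one one_lt_two] at this
  linarith

lemma tlog_add_one_le {s : ℝ} (hs : 1 ≤ s) : tlog (s + 1) ≤ tlog s + 1 :=
  (tlog_mono (by linarith) (by linarith)).trans (tlog_two_mul_le (by linarith))

lemma tlog_one_div_sq_le (r : ℝ) : tlog (1 / r ^ 2) ≤ 2 * tlog (1 / r) := by
  refine max_le ?_ (by linarith [one_le_tlog (1 / r)])
  rw [← one_div_pow, Real.logb_pow]
  push_cast
  linarith [le_max_left (Real.logb 2 (1 / r)) 1,
    show tlog (1 / r) = max (Real.logb 2 (1 / r)) 1 from rfl]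

theorem isGaugeFactor_iterated_tlog : IsGaugeFactor fun r => tlog (tlog (tlog (1 / r))) where
  pos _ _ := tlog_pos _
  anti r hr s hs h := by
    refine tlog_mono (tlog_pos _) (tlog_mono (tlog_pos _) (tlog_mono ?_ ?_))
    · exact one_div_pos.2 hs.1
    · exact one_div_le_one_div_of_le hr.1 h
  tendsto := tendsto_tlog.comp (tendsto_tlog.comp (tendsto_tlog.comp tendsto_one_div_nhdsGT_zero))
  lt_log := by
    filter_upwards [(tendsto_tlog.comp tendsto_one_div_nhdsGT_zero).eventually_ge_atTop 2] with r hr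
    exact (tlog_le_self (one_le_tlog _)).trans_lt (tlog_lt_self hr)
  doubling := by
    refine ⟨1, fun r _ => ?_⟩
    calc _ ≤ tlog (tlog (2 * tlog (1 / r))) :=
          tlog_mono (tlog_pos _) (tlog_mono (tlog_pos _) (tlog_one_div_sq_le r))
      _ ≤ tlog (tlog (tlog (1 / r)) + 1) :=
          tlog_mono (tlog_pos _) (tlog_two_mul_le (tlog_pos _))
      _ ≤ _ := tlog_add_one_le (one_le_tlog _)

lemma eventually_tlog_le_mul_rpow {c ε : ℝ} (hc : 0 < c) (hε : 0 < ε) :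
    ∀ᶠ t in atTop, tlog t ≤ c * t ^ ε := by
  have h2 : 0 < Real.log 2 := Real.log_pos one_lt_two
  have h1 := (isLittleO_log_rpow_atTop hε).bound (mul_pos hc h2)
  have h3 := ((tendsto_rpow_atTop hε).const_mul_atTop hc).eventually_ge_atTop 1
  filter_upwards [h1, h3, eventually_gt_atTop 0] with t ht ht' ht0
  refine max_le ?_ ht'
  rw [Real.logb, div_le_iff₀ h2]
  rw [Real.norm_of_nonneg (Real.rpow_nonneg ht0.le ε)] at ht
  linarith [Real.le_norm_self (Real.log t)]

lemma gaugeMeasure_le_smul {φ ψ : ℝ → ℝ} {c : ℝ} (hc : 0 < c)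
    (h : ∀ᶠ r in 𝓝[>] (0 : ℝ), φ r ≤ c * ψ r) :
    gaugeMeasure (fun r => gauge r * φ r) ≤
      ENNReal.ofReal c • gaugeMeasure fun r => gauge r * ψ r := by
  obtain ⟨δ, hδ, hsub⟩ := mem_nhdsGT_iff_exists_Ioo_subset.1 h
  refine Measure.mkMetric_mono_smul ENNReal.ofReal_ne_top (ENNReal.ofReal_pos.2 hc).ne' ?_
  refine mem_nhdsWithin_of_mem_nhds ?_
  filter_upwards [Iio_mem_nhds (ENNReal.ofReal_pos.2 hδ)] with d hd
  rw [Pi.smul_apply, smul_eq_mul, ← ENNReal.ofReal_mul hc.le]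
  refine ENNReal.ofReal_le_ofReal ?_
  have hlt : d.toReal < δ := ENNReal.toReal_lt_of_lt_ofReal hd
  rcases ENNReal.toReal_nonneg (a := d) |>.eq_or_lt with h0 | h0
  · simp [← h0, gauge]
  · have := mul_le_mul_of_nonneg_left (hsub ⟨h0, hlt⟩) (gauge_nonneg d.toReal)
    linarith

/-- If the `ψ`-measure were finite, it would bound the `φ`-measure after multiplication by every `c
> 0`, and `c → 0` would contradict positivity. -/
lemma gaugeMeasure_eq_top {φ ψ : ℝ → ℝ} {E : Set Plane}
    (hpos : 0 < gaugeMeasure (fun r => gauge r * φ r) E)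
    (h : ∀ c > 0, ∀ᶠ r in 𝓝[>] (0 : ℝ), φ r ≤ c * ψ r) :
    gaugeMeasure (fun r => gauge r * ψ r) E = ⊤ := by
  by_contra hne
  have hlim : Tendsto (fun c : ℝ => ENNReal.ofReal c * gaugeMeasure (fun r => gauge r * ψ r) E)
      (𝓝[>] 0) (𝓝 0) := by
    have h0 : Tendsto ENNReal.ofReal (𝓝[>] 0) (𝓝 0) := by
      rw [← ENNReal.ofReal_zero]
      exact (ENNReal.continuous_ofReal.tendsto 0).mono_left nhdsWithin_le_nhds
    simpa using ENNReal.Tendsto.mul_const h0 (Or.inr hne)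
  refine absurd (ge_of_tendsto hlim ?_) (not_le.2 hpos)
  filter_upwards [self_mem_nhdsWithin] with c hc
  exact gaugeMeasure_le_smul hc (h c hc) E

/-! ### A rapidly growing parameter sequence -/

/-- A strictly increasing sequence of powers of two with prescribed growth. -/
def growthSequence (g : ℕ → ℕ) : ℕ → ℕ
  | 0 => 2
  | n + 1 => 2 ^ max (g (growthSequence g n)) (growthSequence g n)

lemma growthSequence_pos (g : ℕ → ℕ) (n : ℕ) : 0 < growthSequence g n := by
  cases n <;> simp [growthSequence]

lemma growthSequence_strictMono (g : ℕ → ℕ) : StrictMono (growthSequence g) :=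
  strictMono_nat_of_lt_succ fun _ => (le_max_right _ _).trans_lt Nat.lt_two_pow_self

lemma le_growthSequence_succ (g : ℕ → ℕ) (n : ℕ) :
    g (growthSequence g n) ≤ growthSequence g (n + 1) :=
  (le_max_left _ _).trans Nat.lt_two_pow_self.le

lemma isParameter_growthSequence (g : ℕ → ℕ) : IsParameter (growthSequence g) where
  pow_two n := by
    cases n with
    | zero => exact ⟨1, one_pos, rfl⟩
    | succ n => exact ⟨_, lt_max_of_lt_right (growthSequence_pos g n), rfl⟩
  mono := (growthSequence_strictMono g).monotone
  tendsto := (growthSequence_strictMono g).tendsto_atTop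

end Keich

end

theorem theoremA :
    -- every set of the family is a Besicovitch set
    (∀ M : ℕ → ℕ, Keich.IsParameter M → Keich.IsBesicovitch (Keich.limitSet M)) ∧
    -- its measure for the gauge `r² log (1/r)` is finite
    (∀ M : ℕ → ℕ, Keich.IsParameter M → StrictMono M →
      Keich.gaugeMeasure Keich.gauge (Keich.limitSet M) < ⊤) ∧
    -- its measure for the gauge `r² log (1/r) φ(r)` is positive if `M` grows fast enough
    (∀ φ : ℝ → ℝ, Keich.IsGaugeFactor φ → ∃ g : ℕ → ℕ, ∀ M : ℕ → ℕ, Keich.IsParameter M →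
      (∀ᶠ n in Filter.atTop, g (M n) ≤ M (n + 1)) →
      0 < Keich.gaugeMeasure (fun r => Keich.gauge r * φ r) (Keich.limitSet M)) ∧
    -- the example `φ(r) = log log log (1/r)`
    Keich.IsGaugeFactor (fun r => Keich.tlog (Keich.tlog (Keich.tlog (1 / r)))) ∧
    -- one set whose sharp gauge lies below all `r² log (1/r) (log log (1/r)) ^ ε`
    (∃ M : ℕ → ℕ, Keich.IsParameter M ∧ StrictMono M ∧
      Keich.IsBesicovitch (Keich.limitSet M) ∧
      Keich.gaugeMeasure Keich.gauge (Keich.limitSet M) < ⊤ ∧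
      ∀ ε : ℝ, 0 < ε →
        Keich.gaugeMeasure
          (fun r => Keich.gauge r * (Keich.tlog (Keich.tlog (1 / r))) ^ ε)
          (Keich.limitSet M) = ⊤) := by
  refine ⟨fun M hM => Keich.isBesicovitch_limitSet hM,
    fun M hM h => Keich.gaugeMeasure_limitSet_lt_top hM h,
    fun φ hφ => Keich.exists_growth_gaugeMeasure_pos hφ, Keich.isGaugeFactor_iterated_tlog, ?_⟩
  obtain ⟨g, hg⟩ := Keich.exists_growth_gaugeMeasure_pos Keich.isGaugeFactor_iterated_tlog
  have hM := Keich.isParameter_growthSequence g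
  have hmono := Keich.growthSequence_strictMono g
  refine ⟨Keich.growthSequence g, hM, hmono, Keich.isBesicovitch_limitSet hM,
    Keich.gaugeMeasure_limitSet_lt_top hM hmono, fun ε hε => ?_⟩
  refine Keich.gaugeMeasure_eq_top
    (hg _ hM (Filter.Eventually.of_forall (Keich.le_growthSequence_succ g))) fun c hc => ?_
  -- With `t = log log (1/r)` the comparison of `log log log (1/r)` to its `ε`-power is `log t ≤ c *
  -- t ^ ε` for large `t`.
  exact (Keich.tendsto_tlog.comp (Keich.tendsto_tlog.comp
    Keich.tendsto_one_div_nhdsGT_zero)).eventually (Keich.eventually_tlog_le_mul_rpow hc hε)
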